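/- **Theorem (non-asymptotic analysis of the two-stage IV estimator in a linear confounded MDP).** *Model.* Let $\mathcal S,\mathcal A,\mathcal Z$ be finite sets, $\gamma\in[0,1)$, and $\mathcal E\subseteq[-1,1]$. A confounded MDP has a transition kernel $P(\cdot\mid s,a)$, a reward function $R(s,a)$, and confounder laws on $\mathcal E$. Let $\pi(\cdot\mid s)$ be a target policy. Under $\pi$ from the initial state $s^{(1)}=s_0$, one has $a^{(t)}\sim\pi(\cdot\mid s^{(t)})$, $r^{(t)}=R(s^{(t)},a^{(t)})+\epsilon^{(t)}$, $s^{(t+1)}\sim P(\cdot\mid s^{(t)},a^{(t)})$, where the $\epsilon^{(t)}$ are drawn from a zero-mean law on $\mathcal E$, independently of the states and actions. Put $$V(s_0)=\mathbb E_\pi\Big[\sum_{t\ge1}\gamma^{t-1}r^{(t)}\,\Big|\,s^{(1)}=s_0\Big],\qquad d_{\pi,s_0}(s,a)=(1-\gamma)\sum_{t\ge1}\gamma^{t-1}\,\mathbb P_\pi\big(s^{(t)}=s,a^{(t)}=a\mid s^{(1)}=s_0\big).$$ *Data.* One observes $n$ i.i.d. samples $(s_i,a_i,z_i,r_i,s_i')$,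 where $z_i\sim p$ on $\mathcal Z$, $(s_i,a_i)\sim\rho(\cdot,\cdot\mid z_i)$ and, given these, $\epsilon_i\sim P_{\mathcal E}(\cdot\mid s_i,a_i)$ (a law on $\mathcal E$, not observed) and $s_i'\sim P(\cdot\mid s_i,a_i)$ are independent, and $r_i=R(s_i,a_i)+\epsilon_i$. *Assumptions.* (1) Linear structure: for a known $\phi:\mathcal S\times\mathcal A\to\mathbb R^d$ and unknown $\nu:\mathcal S\to\mathbb R^d$, $w\in\mathbb R^d$, one has $P(s'\mid s,a)=\phi(s,a)^\top\nu(s')$ and $R(s,a)=\phi(s,a)^\top w$ for all $s,a,s'$, with $\|\phi(s,a)\|_2\le1$ for all $s,a$, $\|w\|_2\le1$, and $\big\|\sum_s\nu(s)\phi(s,a)^\top\big\|\le1$ (operator norm) for all $a$. (2) Instrumental variable: $\mathbb E[\epsilon_i\mid z_i]=0$ (and $z_i\perp\epsilon_i\mid(s_i,a_i)$, which holds by the way the data are generated). (3) Instrumental sufficient coverage: with $\phi_\rho(z)=\sum_{s,a}\rho(s,a\mid z)\phi(s,a)$ and $\Sigma=\sum_z p(z)\phi_\rho(z)\phi_\rho(z)^\top$,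 the smallest eigenvalue $\underline\sigma$ of $\Sigma$ is positive. *Estimator.* Let $\hat\rho(s,a\mid z)=\frac{\#\{i:\,s_i=s,\,a_i=a,\,z_i=z\}}{\max\{\#\{i:\,z_i=z\},1\}}$, $\phi_{\hat\rho}(z)=\sum_{s,a}\hat\rho(s,a\mid z)\phi(s,a)$, $\phi_\pi(s)=\sum_a\pi(a\mid s)\phi(s,a)$, and $$\hat\Sigma=\tfrac1n\sum_i\phi_{\hat\rho}(z_i)\phi_{\hat\rho}(z_i)^\top,\quad \hat B=\tfrac1n\sum_i\phi_{\hat\rho}(z_i)\phi_\pi(s_i')^\top,\quad \hat\tau=\tfrac1n\sum_i\phi_{\hat\rho}(z_i)r_i,$$ $$\hat w=\hat\Sigma^{-1}\hat\tau,\qquad \hat A=\hat\Sigma^{-1}\hat B,\qquad \hat V(s)=\phi_\pi(s)^\top(I-\gamma\hat A)^{-1}\hat w .$$ *Claim.* There is a universal constant $C>0$ such that, for every such model and every $\delta\in(0,1)$, with $L=\log\big(2d|\mathcal S||\mathcal A||\mathcal Z|/\delta\big)$, whenever $$n\ \ge\ C\,\frac{d^2|\mathcal Z|L}{\underline\sigma^3(1-\gamma)^2},$$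 the following holds with probability at least $1-\delta$: the matrices $\hat\Sigma$ and $I-\gamma\hat A$ are invertible and, simultaneously for all $s_0\in\mathcal S$, $$|\hat V(s_0)-V(s_0)|\ \le\ C\left(\sqrt{\frac{\mathbb E_{(s,a)\sim d_{\pi,s_0}}\big[\|\phi(s,a)\|^2_{\Sigma^{-1}}\big]\,d\,L}{\underline\sigma(1-\gamma)^4\,n}}+\sqrt{\frac{\mathbb E_{(s,a)\sim d_{\pi,s_0}}\big[\|\phi(s,a)\|^2_{\Sigma^{-1}}\big]\,d}{\underline\sigma(1-\gamma)^4}}\cdot\frac{|\mathcal Z|L}{n}\right),$$ where $\|a\|_{M}=(a^\top Ma)^{1/2}$. That is, the error is $\widetilde{\mathcal O}\Big(\sqrt{\mathbb E_{d_{\pi,s_0}}[\|\phi\|^2_{\Sigma^{-1}}]\,d/(\underline\sigma(1-\gamma)^4n)}\Big)$ up to universal constants, the logarithmic factor $L$ and the term of higher order $|\mathcal Z|L/n$. -/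

import Mathlib

open MeasureTheory ProbabilityTheory Matrix

universe u v w

noncomputable section

/-! ### Vectors and matrices -/

/-- The `ℓ₂`-norm of a vector. -/
def l2norm {d : ℕ} (a : Fin d → ℝ) : ℝ := ‖WithLp.toLp 2 a‖

/-- The operator `ℓ₂`-norm of a matrix. -/
def opNorm {d : ℕ} (M : Matrix (Fin d) (Fin d) ℝ) : ℝ := ‖Matrix.toEuclideanCLM (𝕜 := ℝ) M‖

/-- The smallest eigenvalue of a symmetric matrix. -/
def sigmaMin {d : ℕ} (M : Matrix (Fin d) (Fin d) ℝ) : ℝ := sInf (spectrum ℝ M)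

/-- The weighted norm `‖a‖_M = (aᵀ M a)^{1/2}` for a positive semidefinite matrix `M`. -/
def weightedNorm {d : ℕ} (M : Matrix (Fin d) (Fin d) ℝ) (a : Fin d → ℝ) : ℝ :=
  Real.sqrt (a ⬝ᵥ (M *ᵥ a))

/-! ### Confounded Markov decision processes -/

/-- A discounted infinite-horizon confounded MDP with state space `S` and action space `A`.
The reward received at `(s, a)` is `reward s a` plus the (unobserved) confounder. -/
structure ConfoundedMDP (S : Type u) (A : Type v) [MeasurableSpace S] [MeasurableSpace A] where
  /-- the space of values of the confounder -/
  confounderSpace : Set ℝ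
  confounderSpace_subset : confounderSpace ⊆ Set.Icc (-1) 1
  /-- the transition kernel `P(· | s, a)` -/
  transition : Kernel (S × A) S
  [transition_markov : IsMarkovKernel transition]
  /-- the law `P_E(· | s, a)` of the confounder in the offline data, where it may be correlated
  with the state-action pair -/
  confounder : Kernel (S × A) ℝ
  [confounder_markov : IsMarkovKernel confounder]
  confounder_mem : ∀ x, ∀ᵐ e ∂(confounder x), e ∈ confounderSpace
  /-- the law `P_E(·)` of the confounder along the trajectories of the target policy, where it is
  centered and does not depend on the state-action pair -/
  evalConfounder : Measure ℝ
  [evalConfounder_prob : IsProbabilityMeasure evalConfounder]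
  evalConfounder_mem : ∀ᵐ e ∂evalConfounder, e ∈ confounderSpace
  evalConfounder_mean : ∫ e, e ∂evalConfounder = 0
  /-- the deterministic part of the reward -/
  reward : S → A → ℝ
  /-- the discount factor -/
  discount : ℝ
  discount_nonneg : 0 ≤ discount
  discount_lt_one : discount < 1

attribute [instance] ConfoundedMDP.transition_markov ConfoundedMDP.confounder_markov
  ConfoundedMDP.evalConfounder_prob

/-- What the learner records in one sample `(s, a, z, r, s')`; the confounder is not recorded. -/
structure Observation (S : Type u) (A : Type v) (Z : Type w) where
  state : S
  action : A
  instr : Z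
  reward : ℝ
  next : S

namespace ConfoundedMDP

variable {S : Type u} {A : Type v} {Z : Type w}
  [MeasurableSpace S] [MeasurableSpace A] [MeasurableSpace Z]

/-! #### Trajectories of the target policy -/

/-- One step `((s, a), ε) ↦ ((s', a'), ε')` of the process run with the policy `π`:
`s' ∼ P(· | s, a)`, `a' ∼ π(· | s')`, and an independent `ε' ∼ P_E(·)`. -/
def stepKernel (M : ConfoundedMDP S A) (π : Kernel S A) : Kernel ((S × A) × ℝ) ((S × A) × ℝ) :=
  Kernel.prodMkRight ℝ
    ((M.transition ⊗ₖ Kernel.prodMkLeft (S × A) π) ×ₖ Kernel.const (S × A) M.evalConfounder)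

instance (M : ConfoundedMDP S A) (π : Kernel S A) [IsMarkovKernel π] :
    IsMarkovKernel (M.stepKernel π) := by
  unfold stepKernel; infer_instance

/-- The law of the first triple `((s, a), ε)` when the initial state is `s₀`. -/
def initialLaw (M : ConfoundedMDP S A) (π : Kernel S A) (s₀ : S) : Measure ((S × A) × ℝ) :=
  ((Measure.dirac s₀) ⊗ₘ π).prod M.evalConfounder

/-- The law of the whole trajectory `t ↦ ((s_t, a_t), ε_t)`, `t = 0, 1, 2, …`, under the policy
`π` from the initial state `s₀` (the Markov chain with kernel `stepKernel`). -/
def trajectoryLaw (M : ConfoundedMDP S A) (π : Kernel S A) [IsMarkovKernel π] (s₀ : S) :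
    Measure (ℕ → (S × A) × ℝ) :=
  Kernel.trajMeasure (X := fun _ => (S × A) × ℝ) (M.initialLaw π s₀)
    (fun t => (M.stepKernel π).comap (fun h => h ⟨t, Finset.mem_Iic.2 le_rfl⟩)
      (measurable_pi_apply _))

/-- The value function: the expected discounted cumulative reward from the initial state `s₀`.
Time starts at `0`. -/
def value (M : ConfoundedMDP S A) (π : Kernel S A) [IsMarkovKernel π] (s₀ : S) : ℝ :=
  ∫ h, ∑' t : ℕ, M.discount ^ t * (M.reward (h t).1.1 (h t).1.2 + (h t).2)
    ∂(M.trajectoryLaw π s₀)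

/-- The discounted visitation probability of `(s, a)` from the initial state `s₀`. -/
def visitation (M : ConfoundedMDP S A) (π : Kernel S A) [IsMarkovKernel π] (s₀ : S)
    (s : S) (a : A) : ℝ :=
  (1 - M.discount) *
    ∑' t : ℕ, M.discount ^ t * (M.trajectoryLaw π s₀).real {h | (h t).1 = (s, a)}

/-! #### The offline data -/

/-- The law of `((z, (s, a)), (ε, s'))` for one offline sample: `z ∼ p`, `(s, a) ∼ ρ(·, · | z)`,
and, given `(s, a)`, `ε ∼ P_E(· | s, a)` and `s' ∼ P(· | s, a)` independently.
In particular `z` and `ε` are conditionally independent given `(s, a)`. -/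
def sampleLaw (M : ConfoundedMDP S A) (p : Measure Z) (ρ : Kernel Z (S × A)) :
    Measure ((Z × S × A) × ℝ × S) :=
  (p ⊗ₘ ρ) ⊗ₘ Kernel.prodMkLeft Z (M.confounder ×ₖ M.transition)

/-- The confounder has conditional mean zero given the instrumental variable: `E[ε | z] = 0`. -/
def IsInstrument (M : ConfoundedMDP S A) (p : Measure Z) (ρ : Kernel Z (S × A)) : Prop :=
  (M.sampleLaw p ρ)[fun o => o.2.1 | MeasurableSpace.comap (fun o => o.1.1) inferInstance]
    =ᵐ[M.sampleLaw p ρ] 0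

/-- The recorded part `(s, a, z, r, s')` of an offline sample, with `r = R(s, a) + ε`. -/
def observe (M : ConfoundedMDP S A) (o : (Z × S × A) × ℝ × S) : Observation S A Z where
  state := o.1.2.1
  action := o.1.2.2
  instr := o.1.1
  reward := M.reward o.1.2.1 o.1.2.2 + o.2.1
  next := o.2.2

/-- The law of `n` i.i.d. offline samples. -/
def datasetLaw (M : ConfoundedMDP S A) (p : Measure Z) (ρ : Kernel Z (S × A)) (n : ℕ) :
    Measure (Fin n → (Z × S × A) × ℝ × S) :=
  Measure.pi fun _ => M.sampleLaw p ρ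

/-! #### The linear structure -/

/-- `P(s' | s, a) = φ(s, a)ᵀ ν(s')` and `R(s, a) = φ(s, a)ᵀ w`, with normalized `φ`, `ν`, `w`. -/
structure IsLinear [Fintype S] (M : ConfoundedMDP S A) {d : ℕ} (φ : S → A → Fin d → ℝ)
    (ν : S → Fin d → ℝ) (θ : Fin d → ℝ) : Prop where
  transition_eq : ∀ s a s', (M.transition (s, a)).real {s'} = φ s a ⬝ᵥ ν s'
  reward_eq : ∀ s a, M.reward s a = φ s a ⬝ᵥ θ
  feature_norm : ∀ s a, l2norm (φ s a) ≤ 1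
  weight_norm : l2norm θ ≤ 1
  transition_norm : ∀ a, opNorm (∑ s, vecMulVec (ν s) (φ s a)) ≤ 1

end ConfoundedMDP

/-! ### Features -/

section Features

variable {S : Type u} {A : Type v} {Z : Type w} [Fintype S] [Fintype A] [Fintype Z]
  [MeasurableSpace S] [MeasurableSpace A] [MeasurableSpace Z] {d : ℕ}

/-- The averaged feature `φ_π(s) = ∑ₐ π(a | s) φ(s, a)`. -/
def policyFeature (φ : S → A → Fin d → ℝ) (π : Kernel S A) (s : S) : Fin d → ℝ :=
  ∑ a, (π s).real {a} • φ s a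

/-- The conditional feature `φ_ρ(z) = ∑_{s, a} ρ(s, a | z) φ(s, a)`. -/
def condFeature (φ : S → A → Fin d → ℝ) (ρ : Kernel Z (S × A)) (z : Z) : Fin d → ℝ :=
  ∑ s, ∑ a, (ρ z).real {(s, a)} • φ s a

/-- The covariance matrix `Σ = ∑_z p(z) φ_ρ(z) φ_ρ(z)ᵀ` of the conditional feature. -/
def featureCov (φ : S → A → Fin d → ℝ) (p : Measure Z) (ρ : Kernel Z (S × A)) :
    Matrix (Fin d) (Fin d) ℝ :=
  ∑ z, p.real {z} • vecMulVec (condFeature φ ρ z) (condFeature φ ρ z)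

/-- The coverage factor `E_{(s, a) ∼ d_{π, s₀}} ‖φ(s, a)‖²_{Σ⁻¹}`. -/
def coverage (M : ConfoundedMDP S A) (φ : S → A → Fin d → ℝ) (p : Measure Z)
    (ρ : Kernel Z (S × A)) (π : Kernel S A) [IsMarkovKernel π] (s₀ : S) : ℝ :=
  ∑ s, ∑ a, M.visitation π s₀ s a * weightedNorm (featureCov φ p ρ)⁻¹ (φ s a) ^ 2

end Features

/-! ### The two-stage estimator, computed from a recorded dataset `D` -/

namespace TwoStage

variable {S : Type u} {A : Type v} {Z : Type w} [Fintype S] [Fintype A]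
  [DecidableEq S] [DecidableEq A] [DecidableEq Z] [MeasurableSpace S] [MeasurableSpace A]
  {d n : ℕ}

/-- Stage one: the empirical conditional probability `ρ̂(s, a | z)`. -/
def rhoHat (D : Fin n → Observation S A Z) (s : S) (a : A) (z : Z) : ℝ :=
  (∑ i, if (D i).state = s ∧ (D i).action = a ∧ (D i).instr = z then (1 : ℝ) else 0) /
    max (∑ i, if (D i).instr = z then (1 : ℝ) else 0) 1

/-- Stage one: the estimated conditional feature `φ_ρ̂(z)`. -/
def featureHat (φ : S → A → Fin d → ℝ) (D : Fin n → Observation S A Z) (z : Z) : Fin d → ℝ :=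
  ∑ s, ∑ a, rhoHat D s a z • φ s a

/-- `Σ̂ = (1/n) ∑ᵢ φ_ρ̂(zᵢ) φ_ρ̂(zᵢ)ᵀ` -/
def sigmaHat (φ : S → A → Fin d → ℝ) (D : Fin n → Observation S A Z) :
    Matrix (Fin d) (Fin d) ℝ :=
  (1 / (n : ℝ)) • ∑ i, vecMulVec (featureHat φ D (D i).instr) (featureHat φ D (D i).instr)

/-- `B̂ = (1/n) ∑ᵢ φ_ρ̂(zᵢ) φ_π(sᵢ')ᵀ` -/
def bHat (φ : S → A → Fin d → ℝ) (π : Kernel S A) (D : Fin n → Observation S A Z) :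
    Matrix (Fin d) (Fin d) ℝ :=
  (1 / (n : ℝ)) • ∑ i, vecMulVec (featureHat φ D (D i).instr) (policyFeature φ π (D i).next)

/-- `τ̂ = (1/n) ∑ᵢ rᵢ φ_ρ̂(zᵢ)` -/
def tauHat (φ : S → A → Fin d → ℝ) (D : Fin n → Observation S A Z) : Fin d → ℝ :=
  (1 / (n : ℝ)) • ∑ i, (D i).reward • featureHat φ D (D i).instr

/-- `ŵ = Σ̂⁻¹ τ̂` -/
def wHat (φ : S → A → Fin d → ℝ) (D : Fin n → Observation S A Z) : Fin d → ℝ :=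
  (sigmaHat φ D)⁻¹ *ᵥ tauHat φ D

/-- `Â = Σ̂⁻¹ B̂` -/
def aHat (φ : S → A → Fin d → ℝ) (π : Kernel S A) (D : Fin n → Observation S A Z) :
    Matrix (Fin d) (Fin d) ℝ :=
  (sigmaHat φ D)⁻¹ * bHat φ π D

/-- `θ̂ = (I - γ Â)⁻¹ ŵ` -/
def thetaHat (φ : S → A → Fin d → ℝ) (π : Kernel S A) (γ : ℝ)
    (D : Fin n → Observation S A Z) : Fin d → ℝ :=
  (1 - γ • aHat φ π D)⁻¹ *ᵥ wHat φ D

/-- The estimated value `V̂(s) = φ_π(s)ᵀ θ̂`. -/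
def valueHat (φ : S → A → Fin d → ℝ) (π : Kernel S A) (γ : ℝ)
    (D : Fin n → Observation S A Z) (s : S) : ℝ :=
  policyFeature φ π s ⬝ᵥ thetaHat φ π γ D

/-- The two matrices inverted by the estimator are invertible. -/
def WellDefined (φ : S → A → Fin d → ℝ) (π : Kernel S A) (γ : ℝ)
    (D : Fin n → Observation S A Z) : Prop :=
  IsUnit (sigmaHat φ D) ∧ IsUnit (1 - γ • aHat φ π D)

end TwoStage

/-- The logarithmic factor `log (2 d |S| |A| |Z| / δ)`. -/
def logFactor (d cS cA cZ : ℕ) (δ : ℝ) : ℝ := Real.log (2 * d * cS * cA * cZ / δ)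

end

/-!
The error of the estimator is written through the Bellman residual. Let `T = ∑ₛ' ν(s') φ_π(s')ᵀ` be
the matrix of the transition operator in feature space and `θ = (1 - γ T)⁻¹ w`, so that the value is
`φ_π(s₀)ᵀ θ` (`IsLinear.value_eq`). For `Δ = θ̂ - θ` and `u = Δ - γ T Δ`, a telescoping identity
expresses `V̂(s₀) - V(s₀) = φ_π(s₀)ᵀ Δ` as `(1 - γ)⁻¹` times the average of `φᵀ u` under the
discounted visitation distribution (`IsLinear.sum_visitation_residual`). By the
Cauchy–Schwarz inequality this is at most `(1 - γ)⁻¹ √coverage ‖u‖_Σ`, so everything reduces to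
`‖u‖_Σ`.

The definition of the estimator gives the exact equation `Σ̂ u = g + γ G Δ`, where
`g = n⁻¹ ∑ᵢ φ_ρ̂(zᵢ) ξᵢ` with the temporal-difference errors `ξᵢ` of `θ`, and `G = B̂ - Σ̂ T` is
`n⁻¹ ∑ᵢ φ_ρ̂(zᵢ) ηᵢᵀ` with the prediction errors `ηᵢ` of the next feature. Here it is used that
`φ_ρ̂(z)` is the average of the observed `φ(sᵢ, aᵢ)` over the samples with `zᵢ = z`
(`sigmaHat_mulVec_apply`). The transition operator contracts the norm `max |φ(s, a)ᵀ x|`, which lies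
between `√σ` times the Euclidean norm and the Euclidean norm. Hence `Δ` is controlled by `u`, the
term `G Δ` is absorbed as soon as `G` has size `σ^(3/2) (1 - γ)`, and `‖u‖_Σ ≤ 4 σ^(-1/2) ‖g‖`
(`sqrt_quadForm_le_of_mulVec_eq`). The same estimate with `g = 0` proves invertibility. This is
where the sample size `d² |Z| L / (σ³ (1 - γ)²)` comes from.

Both `ξ` and `η` are centered given the instrument, but the weights `φ_ρ̂(zᵢ)` depend on the same
data. So `φ_ρ̂` is replaced by the true `φ_ρ`; the difference is, for each `z`, a product of a
fluctuation of order `√N_z` and one of order `1 / √N_z`, which costs `O(L)` for each `z` and yields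
the term `|Z| L / n` (`abs_sum_featureHat_mul_le`). All remaining sums have weights that depend on
the instruments only, and are bounded by one form of Hoeffding's inequality that is conditional on
the instruments (`measureReal_lt_abs_weighted_sum_le`), followed by a union bound.
-/

set_option linter.unusedSectionVars false

/-! ### Euclidean estimates for vectors and matrices -/

section LinearAlgebra

variable {d : ℕ}

lemma l2norm_nonneg (x : Fin d → ℝ) : 0 ≤ l2norm x := norm_nonneg _

lemma l2norm_sq (x : Fin d → ℝ) : l2norm x ^ 2 = x ⬝ᵥ x := by
  rw [l2norm, EuclideanSpace.norm_sq_eq]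
  simp [dotProduct, sq]

lemma l2norm_add_le (x y : Fin d → ℝ) : l2norm (x + y) ≤ l2norm x + l2norm y := by
  simpa [l2norm] using norm_add_le (WithLp.toLp 2 x) (WithLp.toLp 2 y)

lemma l2norm_smul (c : ℝ) (x : Fin d → ℝ) : l2norm (c • x) = |c| * l2norm x := by
  simp [l2norm, norm_smul]

lemma abs_dotProduct_le (x y : Fin d → ℝ) : |x ⬝ᵥ y| ≤ l2norm x * l2norm y := by
  have h := abs_real_inner_le_norm (WithLp.toLp 2 x) (WithLp.toLp 2 y)
  rw [EuclideanSpace.inner_toLp_toLp] at h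
  simpa [l2norm, dotProduct_comm] using h

lemma abs_apply_le_l2norm (x : Fin d → ℝ) (j : Fin d) : |x j| ≤ l2norm x := by
  simpa [l2norm] using PiLp.norm_apply_le (WithLp.toLp 2 x) j

lemma l2norm_le_of_abs_le {x : Fin d → ℝ} {b : ℝ} (hb : 0 ≤ b) (h : ∀ j, |x j| ≤ b) :
    l2norm x ≤ √d * b := by
  refine le_of_sq_le_sq ?_ (by positivity)
  rw [l2norm_sq, mul_pow, Real.sq_sqrt (Nat.cast_nonneg d)]
  calc x ⬝ᵥ x = ∑ j, x j ^ 2 := by simp [dotProduct, sq]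
    _ ≤ ∑ _j : Fin d, b ^ 2 := Finset.sum_le_sum fun j _ =>
        sq_le_sq' (abs_le.1 (h j)).1 (abs_le.1 (h j)).2
    _ = d * b ^ 2 := by simp

lemma l2norm_mulVec_le {M : Matrix (Fin d) (Fin d) ℝ} {b : ℝ} (hb : 0 ≤ b)
    (h : ∀ j k, |M j k| ≤ b) (x : Fin d → ℝ) : l2norm (M *ᵥ x) ≤ d * b * l2norm x := by
  have h1 : ∀ j, |(M *ᵥ x) j| ≤ √d * b * l2norm x := fun j =>
    (abs_dotProduct_le _ _).trans
      (mul_le_mul_of_nonneg_right (l2norm_le_of_abs_le hb (h j)) (l2norm_nonneg x))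
  have h2 := l2norm_le_of_abs_le (by have := l2norm_nonneg x; positivity) h1
  have h3 : √(d : ℝ) * √d = d := Real.mul_self_sqrt (Nat.cast_nonneg d)
  calc _ ≤ √d * (√d * b * l2norm x) := h2
    _ = (√d * √d) * b * l2norm x := by ring
    _ = _ := by rw [h3]

lemma abs_quadForm_le {M : Matrix (Fin d) (Fin d) ℝ} {b : ℝ} (hb : 0 ≤ b)
    (h : ∀ j k, |M j k| ≤ b) (x : Fin d → ℝ) : |x ⬝ᵥ (M *ᵥ x)| ≤ d * b * (x ⬝ᵥ x) := by
  calc _ ≤ l2norm x * l2norm (M *ᵥ x) := abs_dotProduct_le _ _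
    _ ≤ l2norm x * (d * b * l2norm x) :=
        mul_le_mul_of_nonneg_left (l2norm_mulVec_le hb h x) (l2norm_nonneg x)
    _ = d * b * (x ⬝ᵥ x) := by rw [← l2norm_sq]; ring

lemma sigmaMin_mul_dotProduct_le {M : Matrix (Fin d) (Fin d) ℝ} (hM : M.IsHermitian)
    (x : Fin d → ℝ) : sigmaMin M * (x ⬝ᵥ x) ≤ x ⬝ᵥ (M *ᵥ x) := by
  have hspec : ∀ r ∈ spectrum ℝ M, sigmaMin M ≤ r := fun r hr =>
    csInf_le (by rw [hM.spectrum_real_eq_range_eigenvalues]; exact (Set.finite_range _).bddBelow) hr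
  have hH : (M - algebraMap ℝ _ (sigmaMin M)).IsHermitian := by
    refine hM.sub ?_
    rw [Algebra.algebraMap_eq_smul_one]
    simp [IsHermitian]
  have hpos : (M - algebraMap ℝ _ (sigmaMin M)).PosSemidef := by
    rw [hH.posSemidef_iff_eigenvalues_nonneg]
    intro i
    have hi : hH.eigenvalues i ∈ spectrum ℝ (M - algebraMap ℝ _ (sigmaMin M)) := by
      rw [hH.spectrum_real_eq_range_eigenvalues]; exact ⟨i, rfl⟩
    rw [← spectrum.sub_singleton_eq] at hi
    obtain ⟨r, hr, t, ht, h⟩ := hi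
    rw [Set.mem_singleton_iff] at ht
    have := hspec r hr
    simp only [Pi.zero_apply]
    simp only at h
    linarith
  have h := hpos.dotProduct_mulVec_nonneg x
  rw [sub_mulVec, Algebra.algebraMap_eq_smul_one, smul_mulVec, one_mulVec, dotProduct_sub,
    dotProduct_smul] at h
  simp at h
  linarith

/-- Cauchy–Schwarz for the dual pair of norms `‖·‖_{M⁻¹}`, `‖·‖_M`. -/
lemma sq_dotProduct_le_weightedNorm {M : Matrix (Fin d) (Fin d) ℝ} (hM : M.PosDef)
    (x y : Fin d → ℝ) :
    (x ⬝ᵥ y) ^ 2 ≤ weightedNorm M⁻¹ x ^ 2 * (y ⬝ᵥ (M *ᵥ y)) := by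
  have hdet : IsUnit M.det := (isUnit_iff_isUnit_det M).1 hM.isUnit
  have hsymm : Mᵀ = M := by simpa using hM.isHermitian.eq
  have hdot : ∀ a b : Fin d → ℝ, a ⬝ᵥ (M *ᵥ b) = (M *ᵥ a) ⬝ᵥ b := fun a b => by
    rw [dotProduct_mulVec, ← mulVec_transpose, hsymm]
  have hnn : ∀ a, 0 ≤ a ⬝ᵥ (M *ᵥ a) := fun a => by
    simpa using hM.posSemidef.dotProduct_mulVec_nonneg a
  have hinv : M *ᵥ (M⁻¹ *ᵥ x) = x := by
    rw [mulVec_mulVec, mul_nonsing_inv M hdet, one_mulVec]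
  have hw : weightedNorm M⁻¹ x ^ 2 = (M⁻¹ *ᵥ x) ⬝ᵥ (M *ᵥ (M⁻¹ *ᵥ x)) := by
    rw [weightedNorm, Real.sq_sqrt, hinv, dotProduct_comm]
    simpa using hM.inv.posSemidef.dotProduct_mulVec_nonneg x
  have hCS := LinearMap.BilinForm.apply_sq_le_of_symm (toLinearMap₂' ℝ M)
    (fun a => by simpa [toLinearMap₂'_apply'] using hnn a)
    ⟨fun a b => by
      simp only [toLinearMap₂'_apply', RingHom.id_apply]
      rw [hdot a b, dotProduct_comm]⟩ (M⁻¹ *ᵥ x) y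
  simp only [toLinearMap₂'_apply'] at hCS
  rw [hdot (M⁻¹ *ᵥ x) y, hinv] at hCS
  rwa [hw, hinv]

lemma posDef_of_sigmaMin_pos {M : Matrix (Fin d) (Fin d) ℝ} (hM : M.IsHermitian)
    (h : 0 < sigmaMin M) : M.PosDef := by
  refine PosDef.of_dotProduct_mulVec_pos hM fun x hx => ?_
  have h1 := sigmaMin_mul_dotProduct_le hM x
  have h2 : 0 < x ⬝ᵥ x := by
    have := dotProduct_star_self_pos_iff (v := x).2 hx
    simpa using this
  simpa using lt_of_lt_of_le (mul_pos h h2) h1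

lemma isUnit_of_mulVec_eq_zero {M : Matrix (Fin d) (Fin d) ℝ}
    (h : ∀ x, M *ᵥ x = 0 → x = 0) : IsUnit M := by
  rw [← mulVec_injective_iff_isUnit]
  intro x y hxy
  rw [← sub_eq_zero]
  exact h _ (by rw [mulVec_sub]; exact sub_eq_zero.2 hxy)

end LinearAlgebra

/-! ### Hoeffding's inequality conditionally on a finite covariate -/

section Hoeffding

variable {Ω : Type*} [MeasurableSpace Ω] {μ : Measure Ω} [IsProbabilityMeasure μ]
  {Z : Type*} [Fintype Z] [MeasurableSpace Z] [MeasurableSingletonClass Z]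
  {ζ : Ω → Z} {f : Ω → ℝ} {b : ℝ} {n : ℕ}

/-- Hoeffding's lemma on an event `s`: the exponential is bounded by its chord over `[-b, b]`. -/
lemma setIntegral_exp_le_of_setIntegral_eq_zero (hf : Measurable f) (hb : 0 < b)
    (hfb : ∀ᵐ ω ∂μ, |f ω| ≤ b) {s : Set Ω} (hs : ∫ ω in s, f ω ∂μ = 0)
    (c : ℝ) : ∫ ω in s, Real.exp (c * f ω - b ^ 2 * c ^ 2 / 2) ∂μ ≤ μ.real s := by
  have hfb' : ∀ᵐ ω ∂(μ.restrict s), |f ω| ≤ b := ae_restrict_of_ae hfb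
  have hfi : Integrable f (μ.restrict s) :=
    Integrable.of_bound hf.aestronglyMeasurable b (by simpa using hfb')
  have hpt : ∀ᵐ ω ∂(μ.restrict s), Real.exp (c * f ω) ≤
      Real.cosh (c * b) + f ω * (Real.sinh (c * b) / b) := by
    filter_upwards [hfb'] with ω hω
    have h := Real.exp_mul_le_cosh_add_mul_sinh (t := f ω / b)
      (by rw [abs_div, abs_of_pos hb]; exact (div_le_one hb).2 hω) (c * b)
    have e : f ω / b * (c * b) = c * f ω := by field_simp
    rw [e] at h
    exact h.trans_eq (by ring)
  have hcosh : Real.cosh (c * b) ≤ Real.exp (b ^ 2 * c ^ 2 / 2) := by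
    refine (Real.cosh_le_exp_half_sq _).trans_eq (by ring_nf)
  calc ∫ ω in s, Real.exp (c * f ω - b ^ 2 * c ^ 2 / 2) ∂μ
      ≤ ∫ ω in s, (Real.cosh (c * b) + f ω * (Real.sinh (c * b) / b)) *
          Real.exp (-(b ^ 2 * c ^ 2 / 2)) ∂μ := by
        refine integral_mono_of_nonneg (Filter.Eventually.of_forall fun _ => (Real.exp_pos _).le)
          (((integrable_const _).add (hfi.mul_const _)).mul_const _) ?_
        filter_upwards [hpt] with ω hω
        rw [sub_eq_add_neg, Real.exp_add]
        exact mul_le_mul_of_nonneg_right hω (Real.exp_pos _).le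
    _ = μ.real s * (Real.cosh (c * b) * Real.exp (-(b ^ 2 * c ^ 2 / 2))) := by
        rw [integral_mul_const, integral_add (integrable_const _) (hfi.mul_const _),
          integral_mul_const, hs]
        simp
        ring
    _ ≤ μ.real s * 1 := by
        refine mul_le_mul_of_nonneg_left ?_ measureReal_nonneg
        calc _ ≤ Real.exp (b ^ 2 * c ^ 2 / 2) * Real.exp (-(b ^ 2 * c ^ 2 / 2)) :=
              mul_le_mul_of_nonneg_right hcosh (Real.exp_pos _).le
          _ = 1 := by rw [← Real.exp_add]; simp
    _ = μ.real s := mul_one _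

/-- The exponential supermartingale bound for sums whose weights may depend on all covariates
`ζ (ω₁), …, ζ (ωₙ)`. The expectation splits over the finitely many values of the covariate vector,
and factorizes on each of these events. -/
lemma integral_exp_weighted_sum_le_one (hζ : Measurable ζ) (hf : Measurable f) (hb : 0 < b)
    (hfb : ∀ᵐ ω ∂μ, |f ω| ≤ b) (h0 : ∀ z, ∫ ω in ζ ⁻¹' {z}, f ω ∂μ = 0)
    (c : (Fin n → Z) → Fin n → ℝ) :
    Integrable (fun ω : Fin n → Ω => Real.exp (∑ i, (c (fun i => ζ (ω i)) i * f (ω i) -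
        b ^ 2 * c (fun i => ζ (ω i)) i ^ 2 / 2))) (Measure.pi fun _ => μ) ∧
      ∫ ω : Fin n → Ω, Real.exp (∑ i, (c (fun i => ζ (ω i)) i * f (ω i) -
        b ^ 2 * c (fun i => ζ (ω i)) i ^ 2 / 2)) ∂(Measure.pi fun _ => μ) ≤ 1 := by
  set F : (Fin n → Z) → Fin n → Ω → ℝ := fun y i =>
    (ζ ⁻¹' {y i}).indicator fun ω => Real.exp (c y i * f ω - b ^ 2 * c y i ^ 2 / 2) with hF
  have hms : ∀ z, MeasurableSet (ζ ⁻¹' {z}) := fun z => hζ (measurableSet_singleton z)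
  have hFi : ∀ y i, Integrable (F y i) μ := by
    intro y i
    refine Integrable.indicator (Integrable.of_bound (by fun_prop) (Real.exp (|c y i| * b)) ?_)
      (hms _)
    filter_upwards [hfb] with ω hω
    rw [Real.norm_eq_abs, abs_of_pos (Real.exp_pos _), Real.exp_le_exp]
    have h1 : c y i * f ω ≤ |c y i| * b := (le_abs_self _).trans (by
      rw [abs_mul]; exact mul_le_mul_of_nonneg_left hω (abs_nonneg _))
    have : 0 ≤ b ^ 2 * c y i ^ 2 / 2 := by positivity
    linarith
  have hdec : (fun ω : Fin n → Ω => Real.exp (∑ i, (c (fun i => ζ (ω i)) i * f (ω i) -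
        b ^ 2 * c (fun i => ζ (ω i)) i ^ 2 / 2))) = fun ω => ∑ y, ∏ i, F y i (ω i) := by
    funext ω
    rw [Finset.sum_eq_single (fun i => ζ (ω i))]
    · rw [Real.exp_sum]
      simp [hF]
    · intro y _ hy
      obtain ⟨i, hi⟩ := Function.ne_iff.1 hy
      refine Finset.prod_eq_zero (Finset.mem_univ i) ?_
      simp only [hF]
      refine Set.indicator_of_notMem ?_ _
      simpa using fun h => hi h.symm
    · simp
  have hprod : ∀ y : Fin n → Z, Integrable (fun ω : Fin n → Ω => ∏ i, F y i (ω i))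
      (Measure.pi fun _ => μ) := fun y => Integrable.fintype_prod (hFi y)
  rw [hdec]
  refine ⟨integrable_finsetSum _ fun y _ => hprod y, ?_⟩
  rw [integral_finsetSum _ fun y _ => hprod y]
  calc ∑ y, ∫ ω : Fin n → Ω, ∏ i, F y i (ω i) ∂(Measure.pi fun _ => μ)
      = ∑ y : Fin n → Z, ∏ i, ∫ ω, F y i ω ∂μ := by
        refine Finset.sum_congr rfl fun y _ => integral_fintype_prod_eq_prod _
    _ ≤ ∑ y : Fin n → Z, ∏ i, μ.real (ζ ⁻¹' {y i}) := by
        refine Finset.sum_le_sum fun y _ => Finset.prod_le_prod (fun i _ => ?_) fun i _ => ?_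
        · exact integral_nonneg fun ω => Set.indicator_nonneg (fun _ _ => (Real.exp_pos _).le) _
        · rw [hF, integral_indicator (hms _)]
          exact setIntegral_exp_le_of_setIntegral_eq_zero hf hb hfb (h0 _) _
    _ = ∏ _i : Fin n, ∑ z, μ.real (ζ ⁻¹' {z}) := by
        rw [Finset.prod_univ_sum]; simp
    _ = 1 := by
        have : ∑ z, μ.real (ζ ⁻¹' {z}) = 1 := by
          rw [sum_measureReal_preimage_singleton _ fun z _ => hms z]; simp
        simp [this]

/-- Hoeffding's inequality with weights that may depend on all covariates: the radius is the
random quantity `b √(2 x ∑ cᵢ²)`, and `∑ cᵢ²` is a function of the covariates alone. -/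
lemma measureReal_lt_weighted_sum_le (hζ : Measurable ζ) (hf : Measurable f) (hb : 0 < b)
    (hfb : ∀ᵐ ω ∂μ, |f ω| ≤ b) (h0 : ∀ z, ∫ ω in ζ ⁻¹' {z}, f ω ∂μ = 0)
    (c : (Fin n → Z) → Fin n → ℝ) {x : ℝ} (hx : 0 ≤ x) :
    (Measure.pi fun _ => μ).real {ω : Fin n → Ω |
      b * √(2 * x * ∑ i, c (fun i => ζ (ω i)) i ^ 2) < ∑ i, c (fun i => ζ (ω i)) i * f (ω i)} ≤
    Real.exp (-x) := by
  -- the optimal exponent, which depends on the covariates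
  set l : (Fin n → Z) → ℝ := fun y => √(2 * x / ∑ i, c y i ^ 2) / b with hl
  obtain ⟨hint, hle⟩ := integral_exp_weighted_sum_le_one (n := n) hζ hf hb hfb h0
    (fun y i => l y * c y i)
  have hmarkov := mul_meas_ge_le_integral_of_nonneg
    (Filter.Eventually.of_forall fun _ => (Real.exp_pos _).le) hint (Real.exp x)
  have hsub : {ω : Fin n → Ω |
      b * √(2 * x * ∑ i, c (fun i => ζ (ω i)) i ^ 2) < ∑ i, c (fun i => ζ (ω i)) i * f (ω i)} ⊆
      {ω | Real.exp x ≤ Real.exp (∑ i, (l (fun i => ζ (ω i)) * c (fun i => ζ (ω i)) i * f (ω i) -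
        b ^ 2 * (l (fun i => ζ (ω i)) * c (fun i => ζ (ω i)) i) ^ 2 / 2))} := by
    intro ω hω
    simp only [Set.mem_ofPred_eq, Real.exp_le_exp] at hω ⊢
    generalize (fun i => ζ (ω i)) = y at hω ⊢
    have hv : 0 < ∑ i, c y i ^ 2 := by
      rcases (Finset.sum_nonneg fun i _ => sq_nonneg (c y i)).lt_or_eq with h | h
      · exact h
      · have hc : ∀ i, c y i = 0 := fun i => by
          simpa using (Finset.sum_eq_zero_iff_of_nonneg (fun i _ => sq_nonneg (c y i))).1 h.symm i
            (Finset.mem_univ i)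
        simp [hc] at hω
    have hs : ∑ i, (l y * c y i * f (ω i) - b ^ 2 * (l y * c y i) ^ 2 / 2) =
        l y * (∑ i, c y i * f (ω i)) - b ^ 2 * l y ^ 2 / 2 * ∑ i, c y i ^ 2 := by
      rw [Finset.sum_sub_distrib, Finset.mul_sum, Finset.mul_sum]
      congr 1 <;> exact Finset.sum_congr rfl fun i _ => by ring
    rw [hs]
    generalize (∑ i, c y i * f (ω i)) = t at hω ⊢
    have hlsq : l y ^ 2 * b ^ 2 * ∑ i, c y i ^ 2 = 2 * x := by
      simp only [hl]
      rw [div_pow, Real.sq_sqrt (by positivity)]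
      field_simp
    have hl0 : 0 ≤ l y := by simp only [hl]; positivity
    have hlt : l y * (b * √(2 * x * ∑ i, c y i ^ 2)) = 2 * x := by
      rw [← hlsq]
      have : l y ^ 2 * b ^ 2 * (∑ i, c y i ^ 2) * ∑ i, c y i ^ 2 =
        (l y * b * ∑ i, c y i ^ 2) ^ 2 := by ring
      rw [this, Real.sqrt_sq (by positivity)]
      ring
    have := mul_le_mul_of_nonneg_left hω.le hl0
    rw [hlt] at this
    nlinarith
  have h1 := measureReal_mono (μ := Measure.pi fun _ : Fin n => μ) hsub
  have h2 := hmarkov.trans hle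
  rw [Real.exp_neg, ← one_div, le_div_iff₀' (Real.exp_pos x)]
  exact (mul_le_mul_of_nonneg_left h1 (Real.exp_pos x).le).trans h2

lemma measureReal_lt_abs_weighted_sum_le (hζ : Measurable ζ) (hf : Measurable f) (hb : 0 < b)
    (hfb : ∀ᵐ ω ∂μ, |f ω| ≤ b) (h0 : ∀ z, ∫ ω in ζ ⁻¹' {z}, f ω ∂μ = 0)
    (c : (Fin n → Z) → Fin n → ℝ) {x : ℝ} (hx : 0 ≤ x) :
    (Measure.pi fun _ => μ).real {ω : Fin n → Ω |
      b * √(2 * x * ∑ i, c (fun i => ζ (ω i)) i ^ 2) < |∑ i, c (fun i => ζ (ω i)) i * f (ω i)|} ≤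
    2 * Real.exp (-x) := by
  have h1 := measureReal_lt_weighted_sum_le (n := n) hζ hf hb hfb h0 c hx
  have h2 := measureReal_lt_weighted_sum_le (n := n) hζ hf.neg hb (by simpa using hfb)
    (fun z => by simp [integral_neg, h0 z]) c hx
  refine (measureReal_mono ?_).trans
    ((measureReal_union_le _ _).trans ((add_le_add h1 h2).trans_eq (two_mul _).symm))
  intro ω hω
  simp only [Set.mem_ofPred_eq, Set.mem_union, Pi.neg_apply, mul_neg,
    Finset.sum_neg_distrib] at hω ⊢
  exact lt_abs.1 hω

end Hoeffding

/-! ### One-dimensional marginals of Markov chains -/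

section Marginals

lemma ProbabilityTheory.Kernel.comap_comp_measure {α β γ : Type*} [MeasurableSpace α]
    [MeasurableSpace β] [MeasurableSpace γ] (κ : Kernel β γ) {e : α → β} (he : Measurable e)
    (m : Measure α) : (κ.comap e he) ∘ₘ m = κ ∘ₘ (m.map e) := by
  rw [← Kernel.comp_deterministic_eq_comap, ← Measure.comp_assoc,
    Measure.deterministic_comp_eq_map]

variable {X : Type*} [MeasurableSpace X]

/-- The law on trajectories of the Markov chain with initial law `m` and transition kernel `κ`. -/
noncomputable def markovChainLaw (m : Measure X) (κ : Kernel X X) [IsMarkovKernel κ] :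
    Measure (ℕ → X) :=
  Kernel.trajMeasure (X := fun _ => X) m
    (fun t => κ.comap (fun h => h ⟨t, Finset.mem_Iic.2 le_rfl⟩) (measurable_pi_apply _))

variable (m : Measure X) (κ : Kernel X X) [IsMarkovKernel κ]

instance [IsProbabilityMeasure m] : IsProbabilityMeasure (markovChainLaw m κ) := by
  unfold markovChainLaw; infer_instance

lemma map_markovChainLaw_zero :
    (markovChainLaw m κ).map (fun h => h 0) = m := by
  have h0 : (fun h : ℕ → X => h 0) =
      (fun y : (i : Finset.Iic 0) → X => y ⟨0, Finset.mem_Iic.2 le_rfl⟩) ∘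
        Preorder.frestrictLe (π := fun _ => X) 0 := rfl
  rw [h0, ← Measure.map_map (by fun_prop) (by fun_prop), markovChainLaw, Kernel.trajMeasure,
    Measure.map_comp _ _ (by fun_prop), Kernel.traj_map_frestrictLe, Kernel.partialTraj_self,
    Measure.id_comp, Measure.map_map (by fun_prop) (by fun_prop)]
  convert Measure.map_id
  rfl

/-- The chain is only known through its law given the whole past; the past is integrated out. -/
lemma map_markovChainLaw_succ [IsProbabilityMeasure m] (t : ℕ) :
    (markovChainLaw m κ).map (fun h => h (t + 1)) =
      κ ∘ₘ ((markovChainLaw m κ).map (fun h => h t)) := by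
  have h := congrArg Measure.snd (Kernel.map_frestrictLe_trajMeasure_compProd_eq_map_trajMeasure
    (X := fun _ => X) (μ₀ := m) (κ := fun t =>
      κ.comap (fun h => h ⟨t, Finset.mem_Iic.2 le_rfl⟩) (measurable_pi_apply _)) (a := t))
  rw [Measure.snd_compProd, Kernel.comap_comp_measure, Measure.map_map (by fun_prop) (by fun_prop),
    Measure.snd_map_prodMk (by fun_prop)] at h
  exact h.symm

end Marginals

namespace ConfoundedMDP

variable {S : Type u} {A : Type v}

section Occupation

variable [MeasurableSpace S] [MeasurableSpace A]

/-- The transition kernel `((s, a) ↦ (s', a'))` of the state-action pairs under `π`. -/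
noncomputable def pairKernel (M : ConfoundedMDP S A) (π : Kernel S A) : Kernel (S × A) (S × A) :=
  M.transition ⊗ₖ Kernel.prodMkLeft (S × A) π

instance (M : ConfoundedMDP S A) (π : Kernel S A) [IsMarkovKernel π] :
    IsMarkovKernel (M.pairKernel π) := by
  unfold pairKernel; infer_instance

variable (M : ConfoundedMDP S A) (π : Kernel S A) [IsMarkovKernel π] (s₀ : S)

instance : IsProbabilityMeasure (M.initialLaw π s₀) := by
  unfold initialLaw; infer_instance

lemma trajectoryLaw_eq : M.trajectoryLaw π s₀ =
    markovChainLaw (M.initialLaw π s₀) (M.stepKernel π) := rfl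

instance : IsProbabilityMeasure (M.trajectoryLaw π s₀) := by
  rw [trajectoryLaw_eq]; infer_instance

/-- The law of the state-action pair at time `t`. -/
noncomputable def pairLaw (t : ℕ) : Measure (S × A) := (M.trajectoryLaw π s₀).map (fun h => (h t).1)

instance (t : ℕ) : IsProbabilityMeasure (M.pairLaw π s₀ t) := by
  unfold pairLaw; exact Measure.isProbabilityMeasure_map (Measurable.aemeasurable (by fun_prop))

lemma pairLaw_zero : M.pairLaw π s₀ 0 = (Measure.dirac s₀) ⊗ₘ π := by
  have h := map_markovChainLaw_zero (M.initialLaw π s₀) (M.stepKernel π)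
  rw [pairLaw, trajectoryLaw_eq]
  have e : (fun h : ℕ → (S × A) × ℝ => (h 0).1) = Prod.fst ∘ fun h => h 0 := rfl
  rw [e, ← Measure.map_map (by fun_prop) (by fun_prop), h, initialLaw]
  exact Measure.fst_prod

lemma pairLaw_succ (t : ℕ) :
    M.pairLaw π s₀ (t + 1) = M.pairKernel π ∘ₘ M.pairLaw π s₀ t := by
  have h := map_markovChainLaw_succ (M.initialLaw π s₀) (M.stepKernel π) t
  rw [pairLaw, pairLaw, trajectoryLaw_eq]
  have e : ∀ t, (fun h : ℕ → (S × A) × ℝ => (h t).1) = Prod.fst ∘ fun h => h t := fun _ => rfl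
  have hk : (M.stepKernel π).map Prod.fst = (M.pairKernel π).comap Prod.fst measurable_fst := by
    rw [← Kernel.fst_eq, stepKernel, Kernel.fst_prodMkRight, Kernel.fst_prod]
    rfl
  rw [e, e, ← Measure.map_map (by fun_prop) (by fun_prop), h,
    ← Measure.map_map (by fun_prop) (by fun_prop), Measure.map_comp _ _ (by fun_prop), hk,
    Kernel.comap_comp_measure]

/-- Along the trajectory, the confounder has law `evalConfounder` at all times. -/
lemma map_trajectoryLaw_confounder (t : ℕ) :
    (M.trajectoryLaw π s₀).map (fun h => (h t).2) = M.evalConfounder := by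
  have e : ∀ t, (fun h : ℕ → (S × A) × ℝ => (h t).2) = Prod.snd ∘ fun h => h t := fun _ => rfl
  rw [trajectoryLaw_eq, e, ← Measure.map_map (by fun_prop) (by fun_prop)]
  cases t with
  | zero =>
    rw [map_markovChainLaw_zero, initialLaw]
    exact Measure.snd_prod
  | succ t =>
    have hk : (M.stepKernel π).map Prod.snd = Kernel.const _ M.evalConfounder := by
      rw [← Kernel.snd_eq, stepKernel, Kernel.snd_prodMkRight, Kernel.snd_prod]
      rfl
    have : IsProbabilityMeasure
        ((markovChainLaw (M.initialLaw π s₀) (M.stepKernel π)).map fun h => h t) :=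
      Measure.isProbabilityMeasure_map (Measurable.aemeasurable (by fun_prop))
    rw [map_markovChainLaw_succ, Measure.map_comp _ _ (by fun_prop), hk, Measure.const_comp]
    simp

end Occupation

variable [Fintype S] [Fintype A] [MeasurableSpace S] [MeasurableSpace A]
  [DiscreteMeasurableSpace S] [DiscreteMeasurableSpace A]
  (M : ConfoundedMDP S A) (π : Kernel S A) [IsMarkovKernel π] (s₀ : S)
  {d : ℕ} {φ : S → A → Fin d → ℝ} {ν : S → Fin d → ℝ} {θ : Fin d → ℝ}

lemma policyFeature_dotProduct (s : S) (x : Fin d → ℝ) :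
    policyFeature φ π s ⬝ᵥ x = ∑ a, (π s).real {a} * (φ s a ⬝ᵥ x) := by
  simp [policyFeature, sum_dotProduct]

end ConfoundedMDP

/-! ### Discounted visitation and the value function -/

namespace ConfoundedMDP

variable {S : Type u} {A : Type v}
  [Fintype S] [Fintype A] [MeasurableSpace S] [MeasurableSpace A]
  [DiscreteMeasurableSpace S] [DiscreteMeasurableSpace A]
  (M : ConfoundedMDP S A) (π : Kernel S A) [IsMarkovKernel π] (s₀ : S)
  {d : ℕ} {φ : S → A → Fin d → ℝ} {ν : S → Fin d → ℝ} {θ : Fin d → ℝ}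

lemma integral_pairKernel (g : S × A → ℝ) (x : S × A) :
    ∫ y, g y ∂(M.pairKernel π x) =
      ∑ s', (M.transition x).real {s'} * ∑ a, (π s').real {a} * g (s', a) := by
  rw [pairKernel, integral_compProd Integrable.of_finite, integral_fintype Integrable.of_finite]
  simp [Kernel.prodMkLeft_apply, integral_fintype]

lemma integral_pairLaw_zero (g : S × A → ℝ) :
    ∫ y, g y ∂(M.pairLaw π s₀ 0) = ∑ a, (π s₀).real {a} * g (s₀, a) := by
  rw [pairLaw_zero, Measure.integral_compProd Integrable.of_finite, integral_dirac]
  simp [integral_fintype]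

lemma integral_pairLaw_succ (g : S × A → ℝ) (t : ℕ) :
    ∫ y, g y ∂(M.pairLaw π s₀ (t + 1)) =
      ∫ x, ∫ y, g y ∂(M.pairKernel π x) ∂(M.pairLaw π s₀ t) := by
  rw [pairLaw_succ, ← Measure.snd_compProd, Measure.snd,
    integral_map measurable_snd.aemeasurable Measurable.of_discrete.aestronglyMeasurable,
    Measure.integral_compProd Integrable.of_finite]

lemma abs_integral_pairLaw_le (g : S × A → ℝ) (t : ℕ) :
    |∫ y, g y ∂(M.pairLaw π s₀ t)| ≤ ∑ y, |g y| := by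
  have h := norm_integral_le_of_norm_le_const (μ := M.pairLaw π s₀ t) (f := g) (C := ∑ y, |g y|)
    (Filter.Eventually.of_forall fun y =>
      Finset.single_le_sum (f := fun y => |g y|) (fun _ _ => abs_nonneg _) (Finset.mem_univ y))
  simpa using h

lemma summable_discount_mul {f : ℕ → ℝ} {b : ℝ} (hf : ∀ t, |f t| ≤ b) :
    Summable fun t => M.discount ^ t * f t := by
  refine Summable.of_norm_bounded (g := fun t => M.discount ^ t * b)
    ((summable_geometric_of_lt_one M.discount_nonneg M.discount_lt_one).mul_right _) fun t => ?_
  rw [norm_mul, norm_pow, Real.norm_eq_abs, abs_of_nonneg M.discount_nonneg]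
  exact mul_le_mul_of_nonneg_left (hf t) (pow_nonneg M.discount_nonneg _)

lemma visitation_eq (s : S) (a : A) : M.visitation π s₀ s a =
    (1 - M.discount) * ∑' t : ℕ, M.discount ^ t * (M.pairLaw π s₀ t).real {(s, a)} := by
  unfold visitation pairLaw
  congr 2
  funext t
  rw [map_measureReal_apply (by fun_prop) (measurableSet_singleton _)]
  rfl

lemma visitation_nonneg (s : S) (a : A) : 0 ≤ M.visitation π s₀ s a := by
  have h1 := M.discount_lt_one
  have h0 := M.discount_nonneg
  exact mul_nonneg (by linarith)
    (tsum_nonneg fun t => mul_nonneg (pow_nonneg h0 _) measureReal_nonneg)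

lemma sum_visitation_mul (g : S → A → ℝ) :
    ∑ s, ∑ a, M.visitation π s₀ s a * g s a =
      (1 - M.discount) * ∑' t : ℕ, M.discount ^ t * ∫ y, g y.1 y.2 ∂(M.pairLaw π s₀ t) := by
  have hs : ∀ y : S × A, Summable fun t : ℕ =>
      M.discount ^ t * ((M.pairLaw π s₀ t).real {y} * g y.1 y.2) := fun y =>
    M.summable_discount_mul (b := |g y.1 y.2|) fun t => by
      rw [abs_mul, abs_of_nonneg measureReal_nonneg]
      exact mul_le_of_le_one_left (abs_nonneg _) measureReal_le_one
  have h1 : ∀ t, M.discount ^ t * ∫ y, g y.1 y.2 ∂(M.pairLaw π s₀ t) =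
      ∑ y : S × A, M.discount ^ t * ((M.pairLaw π s₀ t).real {y} * g y.1 y.2) := fun t => by
    rw [integral_fintype Integrable.of_finite, Finset.mul_sum]
    simp
  simp_rw [h1]
  rw [Summable.tsum_finsetSum fun y _ => hs y, Finset.mul_sum, Fintype.sum_prod_type]
  refine Finset.sum_congr rfl fun s _ => Finset.sum_congr rfl fun a _ => ?_
  rw [visitation_eq, mul_assoc, ← tsum_mul_right]
  simp [mul_assoc]

lemma sum_visitation : ∑ s, ∑ a, M.visitation π s₀ s a = 1 := by
  have h := M.sum_visitation_mul π s₀ fun _ _ => 1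
  simp only [mul_one, integral_const, probReal_univ, smul_eq_mul,
    tsum_geometric_of_lt_one M.discount_nonneg M.discount_lt_one] at h
  rw [h]
  exact mul_inv_cancel₀ (by have := M.discount_lt_one; linarith)

lemma integrable_confounder_of_ae_mem {α : Type*} [MeasurableSpace α] {m : Measure α}
    [IsFiniteMeasure m] {f : α → ℝ} (hf : Measurable f)
    (h : ∀ᵐ x ∂m, f x ∈ M.confounderSpace) : Integrable f m :=
  Integrable.of_bound hf.aestronglyMeasurable 1 (h.mono fun _ hx =>
    abs_le.2 (M.confounderSpace_subset hx))

/-- The value is the expected reward under the discounted visitation distribution; the confounder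
drops out because it is centered. -/
lemma one_sub_discount_mul_value : (1 - M.discount) * M.value π s₀ =
    ∑ s, ∑ a, M.visitation π s₀ s a * M.reward s a := by
  set T := M.trajectoryLaw π s₀ with hT
  have hmeas2 : ∀ t, Measurable fun h : ℕ → (S × A) × ℝ => (h t).2 := fun t => by fun_prop
  have hae : ∀ t, ∀ᵐ h ∂T, (h t).2 ∈ M.confounderSpace := fun t =>
    ae_of_ae_map (hmeas2 t).aemeasurable
      (by rw [hT, M.map_trajectoryLaw_confounder]; exact M.evalConfounder_mem)
  have hint1 : ∀ t, Integrable (fun h : ℕ → (S × A) × ℝ => M.reward (h t).1.1 (h t).1.2) T :=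
    fun t => (integrable_map_measure (f := fun h : ℕ → (S × A) × ℝ => (h t).1)
      (g := fun y : S × A => M.reward y.1 y.2) (μ := T)
      Measurable.of_discrete.aestronglyMeasurable
      (Measurable.aemeasurable (by fun_prop))).1 (Integrable.of_finite (μ := M.pairLaw π s₀ t))
  have hint2 : ∀ t, Integrable (fun h : ℕ → (S × A) × ℝ => (h t).2) T := fun t =>
    M.integrable_confounder_of_ae_mem (hmeas2 t) (hae t)
  have hmean : ∀ t, ∫ h, M.reward (h t).1.1 (h t).1.2 + (h t).2 ∂T =
      ∫ y, M.reward y.1 y.2 ∂(M.pairLaw π s₀ t) := fun t => by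
    have h2 : ∫ h, (h t).2 ∂T = 0 := by
      have := integral_map (μ := T) (φ := fun h : ℕ → (S × A) × ℝ => (h t).2)
        (hmeas2 t).aemeasurable (f := fun e : ℝ => e) (by fun_prop)
      rw [← this, hT, M.map_trajectoryLaw_confounder, M.evalConfounder_mean]
    rw [integral_add (hint1 t) (hint2 t), h2, add_zero, pairLaw,
      integral_map (Measurable.aemeasurable (by fun_prop))
        Measurable.of_discrete.aestronglyMeasurable]
  set b : ℝ := ∑ y : S × A, |M.reward y.1 y.2| + 1 with hb
  have hbound : ∀ t, ∀ᵐ h ∂T, |M.reward (h t).1.1 (h t).1.2 + (h t).2| ≤ b := fun t => by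
    filter_upwards [hae t] with h hh
    exact (abs_add_le _ _).trans (add_le_add
      (Finset.single_le_sum (f := fun y : S × A => |M.reward y.1 y.2|) (fun _ _ => abs_nonneg _)
        (Finset.mem_univ (h t).1)) (abs_le.2 (M.confounderSpace_subset hh)))
  have hswap := integral_tsum_of_summable_integral_norm (μ := T)
    (F := fun t h => M.discount ^ t * (M.reward (h t).1.1 (h t).1.2 + (h t).2))
    (fun t => ((hint1 t).add (hint2 t)).const_mul _) (by
      have : ∀ t, ∫ h, ‖M.discount ^ t * (M.reward (h t).1.1 (h t).1.2 + (h t).2)‖ ∂T =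
          M.discount ^ t * ∫ h, |M.reward (h t).1.1 (h t).1.2 + (h t).2| ∂T := fun t => by
        rw [← integral_const_mul]
        simp [abs_of_nonneg M.discount_nonneg]
      simp_rw [this]
      refine M.summable_discount_mul (b := b) fun t => ?_
      have := norm_integral_le_of_norm_le_const (μ := T)
        (f := fun h => |M.reward (h t).1.1 (h t).1.2 + (h t).2|) (C := b) (by
          filter_upwards [hbound t] with h hh
          simpa using hh)
      simpa using this)
  rw [sum_visitation_mul, value, ← hT, ← hswap]
  simp_rw [integral_const_mul, hmean]

/-! ### The Bellman equation in feature space -/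

/-- The matrix `T = ∑ₛ' ν(s') φ_π(s')ᵀ` that represents the transition operator of `π` on value
functions that are linear in the features. -/
noncomputable def transitionMatrix (φ : S → A → Fin d → ℝ) (ν : S → Fin d → ℝ) (π : Kernel S A) :
    Matrix (Fin d) (Fin d) ℝ :=
  ∑ s', vecMulVec (ν s') (policyFeature φ π s')

variable {M}

lemma IsLinear.feature_dotProduct_transitionMatrix (h : M.IsLinear φ ν θ) (s : S) (a : A)
    (x : Fin d → ℝ) : φ s a ⬝ᵥ (transitionMatrix φ ν π *ᵥ x) =
      ∑ s', (M.transition (s, a)).real {s'} * (policyFeature φ π s' ⬝ᵥ x) := by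
  simp only [transitionMatrix, sum_mulVec, dotProduct_sum, h.transition_eq]
  refine Finset.sum_congr rfl fun s' _ => ?_
  rw [vecMulVec_mulVec]
  simp [mul_comm]

/-- Averaging the Bellman residual `φᵀ(x - γ T x)` over the visitation distribution telescopes to
the initial value of `φᵀ x`. -/
lemma IsLinear.sum_visitation_residual (h : M.IsLinear φ ν θ) (x : Fin d → ℝ) :
    ∑ s, ∑ a, M.visitation π s₀ s a *
        (φ s a ⬝ᵥ (x - M.discount • (transitionMatrix φ ν π *ᵥ x))) =
      (1 - M.discount) * (policyFeature φ π s₀ ⬝ᵥ x) := by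
  set m : ℕ → ℝ := fun t => ∫ y, φ y.1 y.2 ⬝ᵥ x ∂(M.pairLaw π s₀ t) with hm
  have h0 : m 0 = policyFeature φ π s₀ ⬝ᵥ x := by
    rw [hm, policyFeature_dotProduct]
    exact M.integral_pairLaw_zero π s₀ _
  have hsucc : ∀ t, ∫ y, φ y.1 y.2 ⬝ᵥ (transitionMatrix φ ν π *ᵥ x) ∂(M.pairLaw π s₀ t) =
      m (t + 1) := fun t => by
    rw [hm]
    simp only
    rw [integral_pairLaw_succ]
    congr 1
    funext y
    rw [h.feature_dotProduct_transitionMatrix π, integral_pairKernel]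
    simp_rw [policyFeature_dotProduct]
  have hsum : Summable fun t => M.discount ^ t * m t :=
    M.summable_discount_mul fun t => M.abs_integral_pairLaw_le π s₀ _ t
  rw [sum_visitation_mul]
  congr 1
  have hterm : ∀ t, M.discount ^ t * ∫ y, φ y.1 y.2 ⬝ᵥ
      (x - M.discount • (transitionMatrix φ ν π *ᵥ x)) ∂(M.pairLaw π s₀ t) =
      M.discount ^ t * m t - M.discount ^ (t + 1) * m (t + 1) := fun t => by
    simp_rw [dotProduct_sub, dotProduct_smul, smul_eq_mul]
    rw [integral_sub Integrable.of_finite Integrable.of_finite, integral_const_mul, hsucc]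
    ring
  simp_rw [hterm]
  rw [Summable.tsum_sub hsum ((summable_nat_add_iff 1).2 hsum), hsum.tsum_eq_zero_add, h0]
  simp

/-- If `θ` solves the Bellman equation in feature space, the value is linear with weight `θ`. -/
lemma IsLinear.value_eq {w : Fin d → ℝ} (h : M.IsLinear φ ν w)
    (hθ : θ - M.discount • (transitionMatrix φ ν π *ᵥ θ) = w) :
    M.value π s₀ = policyFeature φ π s₀ ⬝ᵥ θ := by
  have h1 : 1 - M.discount ≠ 0 := by have := M.discount_lt_one; linarith
  have h2 := h.sum_visitation_residual π s₀ θ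
  rw [hθ] at h2
  simp_rw [← h.reward_eq] at h2
  exact mul_left_cancel₀ h1 ((M.one_sub_discount_mul_value π s₀).trans h2)

lemma abs_policyFeature_dotProduct_le {x : Fin d → ℝ} {b : ℝ} {s : S}
    (hx : ∀ a, |φ s a ⬝ᵥ x| ≤ b) : |policyFeature φ π s ⬝ᵥ x| ≤ b := by
  rw [policyFeature_dotProduct]
  calc _ ≤ ∑ a, |(π s).real {a} * (φ s a ⬝ᵥ x)| := Finset.abs_sum_le_sum_abs _ _
    _ ≤ ∑ a, (π s).real {a} * b := Finset.sum_le_sum fun a _ => by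
        rw [abs_mul, abs_of_nonneg measureReal_nonneg]
        exact mul_le_mul_of_nonneg_left (hx a) measureReal_nonneg
    _ = b := by rw [← Finset.sum_mul, sum_measureReal_singleton]; simp

lemma IsLinear.abs_feature_transitionMatrix_le (h : M.IsLinear φ ν θ) {x : Fin d → ℝ} {b : ℝ}
    (hx : ∀ s a, |φ s a ⬝ᵥ x| ≤ b) (s : S) (a : A) :
    |φ s a ⬝ᵥ (transitionMatrix φ ν π *ᵥ x)| ≤ b := by
  rw [h.feature_dotProduct_transitionMatrix π]
  calc _ ≤ ∑ s', |(M.transition (s, a)).real {s'} * (policyFeature φ π s' ⬝ᵥ x)| :=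
        Finset.abs_sum_le_sum_abs _ _
    _ ≤ ∑ s', (M.transition (s, a)).real {s'} * b := Finset.sum_le_sum fun s' _ => by
        rw [abs_mul, abs_of_nonneg measureReal_nonneg]
        exact mul_le_mul_of_nonneg_left (abs_policyFeature_dotProduct_le π (hx s'))
          measureReal_nonneg
    _ = b := by rw [← Finset.sum_mul, sum_measureReal_singleton]; simp

/-- The Bellman residual controls the vector itself in the norm `x ↦ max |φ(s, a)ᵀ x|`, in which
the transition matrix is a contraction. -/
lemma IsLinear.abs_feature_le_of_residual (h : M.IsLinear φ ν θ) {x : Fin d → ℝ} {b : ℝ}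
    (hx : ∀ s a, |φ s a ⬝ᵥ (x - M.discount • (transitionMatrix φ ν π *ᵥ x))| ≤ b)
    (s : S) (a : A) : |φ s a ⬝ᵥ x| ≤ b / (1 - M.discount) := by
  have h1 := M.discount_lt_one
  have h0 := M.discount_nonneg
  have : Nonempty (S × A) := ⟨(s, a)⟩
  obtain ⟨y, hy⟩ := Finite.exists_max fun y : S × A => |φ y.1 y.2 ⬝ᵥ x|
  have h2 := h.abs_feature_transitionMatrix_le π (x := x) (fun s a => hy (s, a)) y.1 y.2
  have h3 := hx y.1 y.2
  rw [dotProduct_sub, dotProduct_smul, smul_eq_mul] at h3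
  refine (hy (s, a)).trans ?_
  rw [le_div_iff₀ (by linarith)]
  have h4 : |φ y.1 y.2 ⬝ᵥ x| ≤ b + M.discount * |φ y.1 y.2 ⬝ᵥ x| := by
    calc |φ y.1 y.2 ⬝ᵥ x| = |(φ y.1 y.2 ⬝ᵥ x - M.discount *
            (φ y.1 y.2 ⬝ᵥ (transitionMatrix φ ν π *ᵥ x))) +
            M.discount * (φ y.1 y.2 ⬝ᵥ (transitionMatrix φ ν π *ᵥ x))| := by ring_nf
      _ ≤ _ := (abs_add_le _ _).trans (add_le_add h3 (by
          rw [abs_mul, abs_of_nonneg h0]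
          exact mul_le_mul_of_nonneg_left h2 h0))
  linarith

end ConfoundedMDP

/-! ### Perturbation of the linear system -/

section Perturbation

variable {d : ℕ} {Sig Sh G : Matrix (Fin d) (Fin d) ℝ} {σ γ : ℝ}

lemma sqrt_mul_l2norm_le {x : Fin d → ℝ} (hσ : 0 ≤ σ)
    (h : σ * (x ⬝ᵥ x) ≤ x ⬝ᵥ (Sig *ᵥ x)) : √σ * l2norm x ≤ √(x ⬝ᵥ (Sig *ᵥ x)) := by
  refine Real.le_sqrt_of_sq_le ?_
  rwa [mul_pow, Real.sq_sqrt hσ, l2norm_sq]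

/-- Stability of the perturbed Bellman equation: if `Σ̂ u = g + γ G Δ`, where `Σ̂ ≥ Σ / 2`,
`Δ` is controlled by its Bellman residual `u`, and `G` is small, then `u` is controlled by `g`. -/
lemma sqrt_quadForm_le_of_mulVec_eq (hσ : 0 < σ) (hγ0 : 0 ≤ γ) (hγ1 : γ < 1)
    (hSig : ∀ x, σ * (x ⬝ᵥ x) ≤ x ⬝ᵥ (Sig *ᵥ x))
    (hSh : ∀ x, x ⬝ᵥ (Sig *ᵥ x) / 2 ≤ x ⬝ᵥ (Sh *ᵥ x))
    {κ : ℝ} (hG : ∀ x, l2norm (G *ᵥ x) ≤ κ * l2norm x) (hκ : κ ≤ σ * √σ * (1 - γ) / 4)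
    {u g Δ : Fin d → ℝ} (hΔ : √σ * (1 - γ) * l2norm Δ ≤ l2norm u)
    (hu : Sh *ᵥ u = g + γ • (G *ᵥ Δ)) :
    √(u ⬝ᵥ (Sig *ᵥ u)) ≤ 4 / √σ * l2norm g := by
  set Q := √(u ⬝ᵥ (Sig *ᵥ u)) with hQ
  have hs : 0 < √σ := Real.sqrt_pos.2 hσ
  have hss : √σ * √σ = σ := Real.mul_self_sqrt hσ.le
  have hQ0 : 0 ≤ Q := Real.sqrt_nonneg _
  have hΔ0 := l2norm_nonneg Δ
  have hu0 := l2norm_nonneg u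
  have hg0 := l2norm_nonneg g
  have hquad : 0 ≤ u ⬝ᵥ (Sig *ᵥ u) := le_trans (by rw [← l2norm_sq]; positivity) (hSig u)
  have hQsq : Q ^ 2 = u ⬝ᵥ (Sig *ᵥ u) := Real.sq_sqrt hquad
  have h1 : √σ * l2norm u ≤ Q := sqrt_mul_l2norm_le hσ.le (hSig u)
  have h2 : l2norm (G *ᵥ Δ) ≤ √σ * Q / 4 := by
    calc l2norm (G *ᵥ Δ) ≤ κ * l2norm Δ := hG Δ
      _ ≤ σ * √σ * (1 - γ) / 4 * l2norm Δ := mul_le_mul_of_nonneg_right hκ hΔ0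
      _ = σ / 4 * (√σ * (1 - γ) * l2norm Δ) := by ring
      _ ≤ σ / 4 * l2norm u := mul_le_mul_of_nonneg_left hΔ (by positivity)
      _ = √σ / 4 * (√σ * l2norm u) := by linear_combination (-l2norm u / 4) * hss
      _ ≤ √σ / 4 * Q := mul_le_mul_of_nonneg_left h1 (by positivity)
      _ = √σ * Q / 4 := by ring
  have h3 : l2norm (g + γ • (G *ᵥ Δ)) ≤ l2norm g + √σ * Q / 4 := by
    refine (l2norm_add_le _ _).trans (add_le_add le_rfl ?_)
    rw [l2norm_smul, abs_of_nonneg hγ0]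
    exact (mul_le_of_le_one_left (l2norm_nonneg _) hγ1.le).trans h2
  have h4 : Q ^ 2 / 2 ≤ l2norm u * (l2norm g + √σ * Q / 4) := by
    rw [hQsq]
    refine (hSh u).trans ?_
    rw [hu]
    exact (le_abs_self _).trans ((abs_dotProduct_le _ _).trans
      (mul_le_mul_of_nonneg_left h3 hu0))
  have h5 : √σ * (Q ^ 2 / 2) ≤ Q * (l2norm g + √σ * Q / 4) := by
    calc √σ * (Q ^ 2 / 2) ≤ √σ * (l2norm u * (l2norm g + √σ * Q / 4)) :=
          mul_le_mul_of_nonneg_left h4 hs.le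
      _ = (√σ * l2norm u) * (l2norm g + √σ * Q / 4) := by ring
      _ ≤ _ := mul_le_mul_of_nonneg_right h1 (by positivity)
  rcases hQ0.eq_or_lt with h | h
  · rw [← h]; positivity
  · have h6 : Q * (√σ * Q / 4) ≤ Q * l2norm g := by nlinarith
    have h7 := le_of_mul_le_mul_left h6 h
    rw [div_mul_eq_mul_div, le_div_iff₀ hs]
    linarith

end Perturbation

/-! ### The estimator on a well-concentrated dataset -/

namespace TwoStage

section Counts

variable {S : Type u} {A : Type v} {Z : Type w} [Fintype S] [Fintype A] [Fintype Z]
  [DecidableEq S] [DecidableEq A] [DecidableEq Z] {d n : ℕ} {φ : S → A → Fin d → ℝ}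

/-- The number of observations with instrument `z`. -/
noncomputable def instrCount (D : Fin n → Observation S A Z) (z : Z) : ℝ :=
  ∑ i, if (D i).instr = z then (1 : ℝ) else 0

/-- The sum of `h i` over the observations with instrument `z`. -/
noncomputable def groupSum (D : Fin n → Observation S A Z) (h : Fin n → ℝ) (z : Z) : ℝ :=
  ∑ i, if (D i).instr = z then h i else 0

variable {D : Fin n → Observation S A Z}

lemma instrCount_nonneg (z : Z) : 0 ≤ instrCount D z :=
  Finset.sum_nonneg fun i _ => by split_ifs <;> norm_num

lemma instrCount_eq_zero_or_one_le (z : Z) : instrCount D z = 0 ∨ 1 ≤ instrCount D z := by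
  have h : instrCount D z = ((Finset.univ.filter fun i => (D i).instr = z).card : ℝ) := by
    simp [instrCount]
  rw [h]
  rcases Nat.eq_zero_or_pos (Finset.univ.filter fun i => (D i).instr = z).card with h | h
  · left; exact_mod_cast h
  · right; exact_mod_cast h

lemma instr_ne_of_instrCount_eq_zero {z : Z} (h : instrCount D z = 0) (i : Fin n) :
    (D i).instr ≠ z := by
  intro hi
  have := (Finset.sum_eq_zero_iff_of_nonneg (fun i _ => by split_ifs <;> norm_num)).1 h i
    (Finset.mem_univ i)
  simp [hi] at this

lemma sum_instrCount : ∑ z, instrCount D z = n := by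
  unfold instrCount
  rw [Finset.sum_comm]
  simp

lemma sum_instr_mul (Ψ : Z → ℝ) (h : Fin n → ℝ) :
    ∑ i, Ψ (D i).instr * h i = ∑ z, Ψ z * groupSum D h z := by
  simp only [groupSum, Finset.mul_sum]
  rw [Finset.sum_comm]
  simp

lemma featureHat_eq_zero {z : Z} (h : instrCount D z = 0) : featureHat φ D z = 0 := by
  simp [featureHat, rhoHat, instr_ne_of_instrCount_eq_zero h]

/-- Without a division the identity also holds for instruments that do not occur. -/
lemma instrCount_mul_featureHat (z : Z) (j : Fin d) : instrCount D z * featureHat φ D z j =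
    groupSum D (fun i => φ (D i).state (D i).action j) z := by
  rcases instrCount_eq_zero_or_one_le (D := D) z with h | h
  · simp [h, groupSum, instr_ne_of_instrCount_eq_zero h]
  · have hmax : max (∑ i, if (D i).instr = z then (1 : ℝ) else 0) 1 = instrCount D z :=
      max_eq_left h
    have h0 : instrCount D z ≠ 0 := by linarith
    simp only [featureHat, rhoHat, hmax, Finset.sum_apply, Pi.smul_apply, smul_eq_mul,
      Finset.mul_sum, groupSum]
    have : ∀ s a, instrCount D z * ((∑ i, if (D i).state = s ∧ (D i).action = a ∧ (D i).instr = z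
        then (1 : ℝ) else 0) / instrCount D z * φ s a j) =
        ∑ i, if (D i).state = s then (if (D i).action = a then
          (if (D i).instr = z then φ s a j else 0) else 0) else 0 := fun s a => by
      rw [← mul_assoc, mul_div_cancel₀ _ h0, Finset.sum_mul]
      refine Finset.sum_congr rfl fun i _ => ?_
      by_cases h1 : (D i).state = s <;> by_cases h2 : (D i).action = a <;> simp [h1, h2]
    simp_rw [this]
    simp_rw [Finset.sum_comm (s := (Finset.univ : Finset A)) (t := (Finset.univ : Finset (Fin n)))]
    rw [Finset.sum_comm]
    refine Finset.sum_congr rfl fun i _ => ?_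
    rw [Finset.sum_eq_single (D i).state, Finset.sum_eq_single (D i).action]
    · simp
    · intro a _ ha; simp [ha.symm]
    · simp
    · intro s _ hs; simp [hs.symm]
    · simp

lemma groupSum_sub_const (h : Fin n → ℝ) (c : ℝ) (z : Z) :
    groupSum D (fun i => h i - c) z = groupSum D h z - instrCount D z * c := by
  simp only [groupSum, instrCount, Finset.sum_mul, ← Finset.sum_sub_distrib]
  refine Finset.sum_congr rfl fun i _ => ?_
  split_ifs <;> simp

lemma abs_featureHat_le_one (hφ : ∀ s a, l2norm (φ s a) ≤ 1) (z : Z) (j : Fin d) :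
    |featureHat φ D z j| ≤ 1 := by
  rcases instrCount_eq_zero_or_one_le (D := D) z with h | h
  · simp [featureHat_eq_zero h]
  · have h0 : 0 < instrCount D z := by linarith
    have h1 : |instrCount D z * featureHat φ D z j| ≤ instrCount D z := by
      rw [instrCount_mul_featureHat]
      refine (Finset.abs_sum_le_sum_abs _ _).trans (Finset.sum_le_sum fun i _ => ?_)
      split_ifs
      · exact (abs_apply_le_l2norm _ _).trans (hφ _ _)
      · simp
    rw [abs_mul, abs_of_pos h0] at h1
    exact le_of_mul_le_mul_left (by linarith) h0

/-- Replacing the true conditional feature `ψ` by the estimated one in an empirical sum costs a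
product of two fluctuations of order `√(instrCount)` and `1 / √(instrCount)` for each `z`, hence
a constant for each `z`. -/
lemma abs_sum_featureHat_mul_le {ψ : Z → Fin d → ℝ} {x b : ℝ} (hx : 0 ≤ x) (hb : 0 ≤ b)
    {j : Fin d} {h : Fin n → ℝ}
    (hfeat : ∀ z, |groupSum D (fun i => φ (D i).state (D i).action j - ψ z j) z| ≤
      2 * √(2 * x * instrCount D z))
    (hgroup : ∀ z, |groupSum D h z| ≤ b * √(2 * x * instrCount D z))
    (hsum : |∑ i, ψ (D i).instr j * h i| ≤ b * √(2 * x * n)) :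
    |∑ i, featureHat φ D (D i).instr j * h i| ≤
      b * √(2 * x * n) + 4 * b * x * Fintype.card Z := by
  have hterm : ∀ z, |(featureHat φ D z j - ψ z j) * groupSum D h z| ≤ 4 * b * x := fun z => by
    rcases instrCount_eq_zero_or_one_le (D := D) z with h0 | h1
    · have : groupSum D h z = 0 := by simp [groupSum, instr_ne_of_instrCount_eq_zero h0]
      rw [this]; simp; positivity
    · have hN : 0 < instrCount D z := by linarith
      have h2 := hfeat z
      rw [groupSum_sub_const, ← instrCount_mul_featureHat, ← mul_sub, abs_mul, abs_of_pos hN] at h2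
      have hs := Real.mul_self_sqrt (show 0 ≤ 2 * x * instrCount D z by positivity)
      rw [abs_mul]
      refine le_of_mul_le_mul_left ?_ hN
      calc instrCount D z * (|featureHat φ D z j - ψ z j| * |groupSum D h z|)
          = (instrCount D z * |featureHat φ D z j - ψ z j|) * |groupSum D h z| := by ring
        _ ≤ (2 * √(2 * x * instrCount D z)) * (b * √(2 * x * instrCount D z)) :=
            mul_le_mul h2 (hgroup z) (abs_nonneg _) (by positivity)
        _ = 2 * b * (√(2 * x * instrCount D z) * √(2 * x * instrCount D z)) := by ring
        _ = instrCount D z * (4 * b * x) := by rw [hs]; ring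
  have hsplit : ∑ i, featureHat φ D (D i).instr j * h i =
      ∑ i, ψ (D i).instr j * h i + ∑ z, (featureHat φ D z j - ψ z j) * groupSum D h z := by
    rw [sum_instr_mul (fun z => featureHat φ D z j), sum_instr_mul (fun z => ψ z j),
      ← Finset.sum_add_distrib]
    exact Finset.sum_congr rfl fun z _ => by ring
  rw [hsplit]
  refine (abs_add_le _ _).trans (add_le_add hsum ?_)
  calc _ ≤ ∑ z, |(featureHat φ D z j - ψ z j) * groupSum D h z| := Finset.abs_sum_le_sum_abs _ _
    _ ≤ ∑ _z : Z, 4 * b * x := Finset.sum_le_sum fun z _ => hterm z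
    _ = 4 * b * x * Fintype.card Z := by simp [mul_comm]

lemma sum_sqrt_instrCount_le {y : ℝ} (hy : 0 ≤ y) :
    ∑ z, √(y * instrCount D z) ≤ √(y * n * Fintype.card Z) := by
  refine Real.le_sqrt_of_sq_le ?_
  refine (sq_sum_le_card_mul_sum_sq).trans_eq ?_
  have : ∀ z, √(y * instrCount D z) ^ 2 = y * instrCount D z := fun z =>
    Real.sq_sqrt (mul_nonneg hy (instrCount_nonneg z))
  simp_rw [this]
  rw [← Finset.mul_sum, sum_instrCount, Finset.card_univ]
  ring

/-- The entrywise error of `n Σ̂`. Each group contributes a fluctuation `√(instrCount)` of the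
feature, and these add up by the Cauchy–Schwarz inequality over the instruments. -/
lemma abs_sum_featureHat_mul_featureHat_sub_le {ψ : Z → Fin d → ℝ} {x : ℝ} (hx : 0 ≤ x)
    {Sig : Matrix (Fin d) (Fin d) ℝ} (hφ : ∀ s a, l2norm (φ s a) ≤ 1) (hψ : ∀ z j, |ψ z j| ≤ 1)
    (hfeat : ∀ z j, |groupSum D (fun i => φ (D i).state (D i).action j - ψ z j) z| ≤
      2 * √(2 * x * instrCount D z)) {j k : Fin d}
    (hcov : |∑ i, (ψ (D i).instr j * ψ (D i).instr k - Sig j k)| ≤ 2 * √(2 * x * n)) :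
    |∑ i, (featureHat φ D (D i).instr j * featureHat φ D (D i).instr k - Sig j k)| ≤
      2 * √(2 * x * n) + 4 * √(2 * x * n * Fintype.card Z) := by
  have hone : ∀ F : Z → ℝ, ∑ i, F (D i).instr = ∑ z, instrCount D z * F z := fun F => by
    have := sum_instr_mul (D := D) F fun _ => 1
    simp only [mul_one] at this
    rw [this]
    exact Finset.sum_congr rfl fun z _ => mul_comm _ _
  have hsplit : ∑ i, (featureHat φ D (D i).instr j * featureHat φ D (D i).instr k - Sig j k) =
      ∑ i, (ψ (D i).instr j * ψ (D i).instr k - Sig j k) +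
      ∑ z, instrCount D z * (featureHat φ D z j * featureHat φ D z k - ψ z j * ψ z k) := by
    rw [← hone fun z => featureHat φ D z j * featureHat φ D z k - ψ z j * ψ z k,
      ← Finset.sum_add_distrib]
    exact Finset.sum_congr rfl fun i _ => by ring
  rw [hsplit]
  refine (abs_add_le _ _).trans (add_le_add hcov ?_)
  have hdev : ∀ z j, |instrCount D z * (featureHat φ D z j - ψ z j)| ≤
      2 * √(2 * x * instrCount D z) := fun z j => by
    have := hfeat z j
    rwa [groupSum_sub_const, ← instrCount_mul_featureHat, ← mul_sub] at this
  have hterm : ∀ z, |instrCount D z * (featureHat φ D z j * featureHat φ D z k - ψ z j * ψ z k)| ≤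
      4 * √(2 * x * instrCount D z) := fun z => by
    have e : instrCount D z * (featureHat φ D z j * featureHat φ D z k - ψ z j * ψ z k) =
        instrCount D z * (featureHat φ D z j - ψ z j) * featureHat φ D z k +
          instrCount D z * (featureHat φ D z k - ψ z k) * ψ z j := by ring
    rw [e]
    refine (abs_add_le _ _).trans ?_
    rw [abs_mul, abs_mul (_ * _) (ψ z j)]
    have h1 := mul_le_of_le_one_right (abs_nonneg (instrCount D z * (featureHat φ D z j - ψ z j)))
      (abs_featureHat_le_one (D := D) hφ z k)
    have h2 := mul_le_of_le_one_right (abs_nonneg (instrCount D z * (featureHat φ D z k - ψ z k)))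
      (hψ z j)
    have h3 := hdev z j
    have h4 := hdev z k
    linarith
  calc _ ≤ ∑ z, |instrCount D z * (featureHat φ D z j * featureHat φ D z k - ψ z j * ψ z k)| :=
        Finset.abs_sum_le_sum_abs _ _
    _ ≤ ∑ z, 4 * √(2 * x * instrCount D z) := Finset.sum_le_sum fun z _ => hterm z
    _ = 4 * ∑ z, √(2 * x * instrCount D z) := (Finset.mul_sum _ _ _).symm
    _ ≤ _ := mul_le_mul_of_nonneg_left (sum_sqrt_instrCount_le (by positivity)) (by norm_num)

end Counts

end TwoStage

/-! ### The covariance matrix of the conditional feature -/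

section Covariance

variable {S : Type u} {A : Type v} {Z : Type w} [Fintype S] [Fintype A] [Fintype Z]
  [MeasurableSpace S] [MeasurableSpace A] [MeasurableSpace Z]
  [DiscreteMeasurableSpace S] [DiscreteMeasurableSpace A] [DiscreteMeasurableSpace Z]
  {d : ℕ} {φ : S → A → Fin d → ℝ} {p : Measure Z} [IsProbabilityMeasure p]
  {ρ : Kernel Z (S × A)} [IsMarkovKernel ρ]

lemma condFeature_dotProduct (z : Z) (x : Fin d → ℝ) :
    condFeature φ ρ z ⬝ᵥ x = ∑ y : S × A, (ρ z).real {y} * (φ y.1 y.2 ⬝ᵥ x) := by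
  simp [condFeature, sum_dotProduct, Fintype.sum_prod_type]

lemma condFeature_apply (z : Z) (j : Fin d) :
    condFeature φ ρ z j = ∑ y : S × A, (ρ z).real {y} * φ y.1 y.2 j := by
  simp [condFeature, Fintype.sum_prod_type]

lemma abs_condFeature_dotProduct_le {x : Fin d → ℝ} {b : ℝ} (hx : ∀ s a, |φ s a ⬝ᵥ x| ≤ b)
    (z : Z) : |condFeature φ ρ z ⬝ᵥ x| ≤ b := by
  rw [condFeature_dotProduct]
  calc _ ≤ ∑ y : S × A, |(ρ z).real {y} * (φ y.1 y.2 ⬝ᵥ x)| := Finset.abs_sum_le_sum_abs _ _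
    _ ≤ ∑ y : S × A, (ρ z).real {y} * b := Finset.sum_le_sum fun y _ => by
        rw [abs_mul, abs_of_nonneg measureReal_nonneg]
        exact mul_le_mul_of_nonneg_left (hx _ _) measureReal_nonneg
    _ = b := by rw [← Finset.sum_mul, sum_measureReal_singleton]; simp

lemma abs_condFeature_le_one (hφ : ∀ s a, l2norm (φ s a) ≤ 1) (z : Z) (j : Fin d) :
    |condFeature φ ρ z j| ≤ 1 := by
  have h := abs_condFeature_dotProduct_le (φ := φ) (ρ := ρ) (x := Pi.single j 1) (b := 1)
    (fun s a => by simpa using (abs_apply_le_l2norm _ j).trans (hφ s a)) z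
  simpa using h

lemma featureCov_apply (j k : Fin d) : featureCov φ p ρ j k =
    ∑ z, p.real {z} * (condFeature φ ρ z j * condFeature φ ρ z k) := by
  simp [featureCov, Matrix.sum_apply, vecMulVec_apply]

lemma isHermitian_featureCov : (featureCov φ p ρ).IsHermitian := by
  ext j k
  simp [featureCov_apply, mul_comm]

lemma quadForm_featureCov (x : Fin d → ℝ) : x ⬝ᵥ (featureCov φ p ρ *ᵥ x) =
    ∑ z, p.real {z} * (condFeature φ ρ z ⬝ᵥ x) ^ 2 := by
  simp only [featureCov, sum_mulVec, dotProduct_sum]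
  refine Finset.sum_congr rfl fun z _ => ?_
  rw [smul_mulVec, vecMulVec_mulVec]
  simp only [dotProduct_smul, smul_eq_mul, MulOpposite.smul_eq_mul_unop, MulOpposite.unop_op]
  rw [dotProduct_comm x]
  ring

lemma quadForm_featureCov_le {x : Fin d → ℝ} {b : ℝ}
    (hx : ∀ s a, |φ s a ⬝ᵥ x| ≤ b) : x ⬝ᵥ (featureCov φ p ρ *ᵥ x) ≤ b ^ 2 := by
  rw [quadForm_featureCov]
  calc _ ≤ ∑ z, p.real {z} * b ^ 2 := Finset.sum_le_sum fun z _ =>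
        mul_le_mul_of_nonneg_left (sq_le_sq' (abs_le.1 (abs_condFeature_dotProduct_le hx z)).1
          (abs_le.1 (abs_condFeature_dotProduct_le hx z)).2) measureReal_nonneg
    _ = b ^ 2 := by rw [← Finset.sum_mul, sum_measureReal_singleton]; simp

/-- For `d = 0` the spectrum is empty, and its infimum is `0` by convention. -/
lemma dim_pos_of_sigmaMin_pos {M : Matrix (Fin d) (Fin d) ℝ} (h : 0 < sigmaMin M) : 0 < d := by
  rcases Nat.eq_zero_or_pos d with rfl | hd
  · simp [sigmaMin] at h
  · exact hd

lemma sigmaMin_featureCov_le_one (hφ : ∀ s a, l2norm (φ s a) ≤ 1)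
    (h : 0 < sigmaMin (featureCov φ p ρ)) : sigmaMin (featureCov φ p ρ) ≤ 1 := by
  have hd := dim_pos_of_sigmaMin_pos h
  have h1 := sigmaMin_mul_dotProduct_le (isHermitian_featureCov (φ := φ) (p := p) (ρ := ρ))
    (Pi.single ⟨0, hd⟩ 1)
  have h2 := quadForm_featureCov_le (φ := φ) (p := p) (ρ := ρ) (x := Pi.single ⟨0, hd⟩ 1) (b := 1)
    (fun s a => by simpa using (abs_apply_le_l2norm _ ⟨0, hd⟩).trans (hφ s a))
  have h3 : (Pi.single ⟨0, hd⟩ 1 : Fin d → ℝ) ⬝ᵥ Pi.single ⟨0, hd⟩ 1 = 1 := by simp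
  rw [h3] at h1
  linarith

end Covariance

namespace TwoStage

variable {S : Type u} {A : Type v} {Z : Type w} [Fintype S] [Fintype A] [Fintype Z]
  [DecidableEq S] [DecidableEq A] [DecidableEq Z]
  [MeasurableSpace S] [MeasurableSpace A] [MeasurableSpace Z] {d n : ℕ}

/-- The temporal-difference error `r + γ φ_π(s')ᵀ θ - φ(s, a)ᵀ θ` of the weight `θ`. -/
noncomputable def tdError (φ : S → A → Fin d → ℝ) (π : Kernel S A) (γ : ℝ) (θ : Fin d → ℝ)
    (o : Observation S A Z) : ℝ :=
  o.reward + γ * (policyFeature φ π o.next ⬝ᵥ θ) - φ o.state o.action ⬝ᵥ θ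

/-- The error `φ_π(s') - Tᵀ φ(s, a)` of the linear prediction of the next feature. -/
noncomputable def nextError (φ : S → A → Fin d → ℝ) (π : Kernel S A) (T : Matrix (Fin d) (Fin d) ℝ)
    (o : Observation S A Z) : Fin d → ℝ :=
  policyFeature φ π o.next - φ o.state o.action ᵥ* T

/-- The event on which all empirical sums used in the analysis are within their Hoeffding radii at
level `exp (-x)`. Here `T` is the transition matrix and `θ` is the weight of the value function. -/
structure Concentrated (φ : S → A → Fin d → ℝ) (π : Kernel S A) (p : Measure Z)
    (ρ : Kernel Z (S × A)) (T : Matrix (Fin d) (Fin d) ℝ) (θ : Fin d → ℝ) (γ x : ℝ)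
    (D : Fin n → Observation S A Z) : Prop where
  cov : ∀ j k, |∑ i, (condFeature φ ρ (D i).instr j * condFeature φ ρ (D i).instr k -
    featureCov φ p ρ j k)| ≤ 2 * √(2 * x * n)
  feature : ∀ z j, |groupSum D (fun i => φ (D i).state (D i).action j - condFeature φ ρ z j) z| ≤
    2 * √(2 * x * instrCount D z)
  td_group : ∀ z, |groupSum D (fun i => tdError φ π γ θ (D i)) z| ≤
    2 / (1 - γ) * √(2 * x * instrCount D z)
  td : ∀ j, |∑ i, condFeature φ ρ (D i).instr j * tdError φ π γ θ (D i)| ≤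
    2 / (1 - γ) * √(2 * x * n)
  next_group : ∀ z k, |groupSum D (fun i => nextError φ π T (D i) k) z| ≤
    2 * √(2 * x * instrCount D z)
  next : ∀ j k, |∑ i, condFeature φ ρ (D i).instr j * nextError φ π T (D i) k| ≤
    2 * √(2 * x * n)

variable {φ : S → A → Fin d → ℝ} {π : Kernel S A} {p : Measure Z} {ρ : Kernel Z (S × A)}
  {T : Matrix (Fin d) (Fin d) ℝ} {θ : Fin d → ℝ} {γ x : ℝ} {D : Fin n → Observation S A Z}

lemma sigmaHat_apply (j k : Fin d) : sigmaHat φ D j k =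
    (1 / (n : ℝ)) * ∑ i, featureHat φ D (D i).instr j * featureHat φ D (D i).instr k := by
  simp [sigmaHat, Matrix.sum_apply, vecMulVec_apply]

/-- In `Σ̂ y`, one of the two estimated features may be replaced by the observed feature, since the
former is the average of the latter over the observations with the same instrument. -/
lemma sigmaHat_mulVec_apply (y : Fin d → ℝ) (j : Fin d) : (sigmaHat φ D *ᵥ y) j =
    (1 / (n : ℝ)) * ∑ i, featureHat φ D (D i).instr j *
      (φ (D i).state (D i).action ⬝ᵥ y) := by
  have hgroup : ∀ z, groupSum D (fun _ => featureHat φ D z ⬝ᵥ y) z =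
      groupSum D (fun i => φ (D i).state (D i).action ⬝ᵥ y) z := fun z => by
    have h1 : groupSum D (fun _ => featureHat φ D z ⬝ᵥ y) z =
        ∑ k, instrCount D z * featureHat φ D z k * y k := by
      have : ∀ k, instrCount D z * featureHat φ D z k * y k =
        instrCount D z * (featureHat φ D z k * y k) := fun k => by ring
      simp_rw [this, ← Finset.mul_sum]
      simp only [groupSum, instrCount, Finset.sum_mul, ite_mul, one_mul, zero_mul]
      rfl
    rw [h1]
    simp_rw [instrCount_mul_featureHat, groupSum, Finset.sum_mul]
    rw [Finset.sum_comm]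
    refine Finset.sum_congr rfl fun i _ => ?_
    split_ifs <;> simp [dotProduct]
  have h2 : (sigmaHat φ D *ᵥ y) j = (1 / (n : ℝ)) *
      ∑ i, featureHat φ D (D i).instr j * (featureHat φ D (D i).instr ⬝ᵥ y) := by
    rw [mulVec, dotProduct]
    simp_rw [sigmaHat_apply, dotProduct, mul_assoc, Finset.mul_sum, Finset.sum_mul]
    rw [Finset.sum_comm]
    simp_rw [mul_assoc, Finset.mul_sum]
  rw [h2]
  congr 1
  have h3 : ∀ F : Fin n → ℝ, ∑ i, featureHat φ D (D i).instr j * F i =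
      ∑ z, featureHat φ D z j * groupSum D F z := sum_instr_mul fun z => featureHat φ D z j
  rw [h3, h3]
  refine Finset.sum_congr rfl fun z _ => ?_
  rw [← hgroup z]
  congr 1
  refine Finset.sum_congr rfl fun i _ => ?_
  split_ifs with h
  · simp only [h]
  · rfl

lemma bHat_mulVec_apply (y : Fin d → ℝ) (j : Fin d) : (bHat φ π D *ᵥ y) j =
    (1 / (n : ℝ)) * ∑ i, featureHat φ D (D i).instr j * (policyFeature φ π (D i).next ⬝ᵥ y) := by
  simp only [bHat, smul_mulVec, sum_mulVec, Pi.smul_apply, Finset.sum_apply, smul_eq_mul]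
  congr 1
  refine Finset.sum_congr rfl fun i _ => ?_
  rw [vecMulVec_mulVec]
  simp

lemma tauHat_add_sub_apply (j : Fin d) :
    (tauHat φ D + γ • (bHat φ π D *ᵥ θ) - sigmaHat φ D *ᵥ θ) j =
      (1 / (n : ℝ)) * ∑ i, featureHat φ D (D i).instr j * tdError φ π γ θ (D i) := by
  simp only [Pi.sub_apply, Pi.add_apply, Pi.smul_apply, smul_eq_mul, sigmaHat_mulVec_apply,
    bHat_mulVec_apply, tauHat, Finset.sum_apply]
  rw [mul_left_comm, ← mul_add, ← mul_sub, Finset.mul_sum, ← Finset.sum_add_distrib,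
    ← Finset.sum_sub_distrib]
  congr 1
  refine Finset.sum_congr rfl fun i _ => ?_
  rw [tdError]
  ring

lemma bHat_sub_apply (j k : Fin d) : (bHat φ π D - sigmaHat φ D * T) j k =
    (1 / (n : ℝ)) * ∑ i, featureHat φ D (D i).instr j * nextError φ π T (D i) k := by
  have h1 : (bHat φ π D - sigmaHat φ D * T) j k =
      (bHat φ π D *ᵥ Pi.single k 1) j - (sigmaHat φ D *ᵥ (T *ᵥ Pi.single k 1)) j := by
    rw [mulVec_mulVec]
    simp
  rw [h1, sigmaHat_mulVec_apply, bHat_mulVec_apply, ← mul_sub, ← Finset.sum_sub_distrib]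
  congr 1
  refine Finset.sum_congr rfl fun i _ => ?_
  rw [nextError, dotProduct_mulVec]
  simp [mul_sub]

section EntryBounds

variable [DiscreteMeasurableSpace S] [DiscreteMeasurableSpace A]
  [DiscreteMeasurableSpace Z] [IsMarkovKernel ρ]

lemma Concentrated.abs_sigmaHat_sub_le (hD : Concentrated φ π p ρ T θ γ x D) (hx : 0 ≤ x)
    (hn : 0 < n) (hφ : ∀ s a, l2norm (φ s a) ≤ 1) (j k : Fin d) :
    |(sigmaHat φ D - featureCov φ p ρ) j k| ≤
      (2 * √(2 * x * n) + 4 * √(2 * x * n * Fintype.card Z)) / n := by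
  have hn' : (0 : ℝ) < n := by exact_mod_cast hn
  have h := abs_sum_featureHat_mul_featureHat_sub_le hx hφ (abs_condFeature_le_one (ρ := ρ) hφ)
    hD.feature (hD.cov j k)
  have e : (sigmaHat φ D - featureCov φ p ρ) j k = (∑ i, (featureHat φ D (D i).instr j *
      featureHat φ D (D i).instr k - featureCov φ p ρ j k)) / n := by
    rw [Matrix.sub_apply, sigmaHat_apply, Finset.sum_sub_distrib]
    simp
    field_simp
  rw [e, abs_div, abs_of_pos hn']
  exact div_le_div_of_nonneg_right h hn'.le

lemma Concentrated.abs_tauHat_add_sub_le (hD : Concentrated φ π p ρ T θ γ x D) (hx : 0 ≤ x)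
    (hγ : γ < 1) (j : Fin d) :
    |(tauHat φ D + γ • (bHat φ π D *ᵥ θ) - sigmaHat φ D *ᵥ θ) j| ≤
      (2 / (1 - γ) * √(2 * x * n) + 4 * (2 / (1 - γ)) * x * Fintype.card Z) / n := by
  have h := abs_sum_featureHat_mul_le hx (div_nonneg two_pos.le (sub_nonneg.2 hγ.le))
    (fun z => hD.feature z j) hD.td_group (hD.td j)
  rw [tauHat_add_sub_apply, one_div_mul_eq_div, abs_div, Nat.abs_cast]
  exact div_le_div_of_nonneg_right h (Nat.cast_nonneg n)

lemma Concentrated.abs_bHat_sub_le (hD : Concentrated φ π p ρ T θ γ x D) (hx : 0 ≤ x)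
    (j k : Fin d) : |(bHat φ π D - sigmaHat φ D * T) j k| ≤
      (2 * √(2 * x * n) + 4 * 2 * x * Fintype.card Z) / n := by
  have h := abs_sum_featureHat_mul_le hx two_pos.le
    (fun z => hD.feature z j) (fun z => hD.next_group z k) (hD.next j k)
  rw [bHat_sub_apply, one_div_mul_eq_div, abs_div, Nat.abs_cast]
  exact div_le_div_of_nonneg_right h (Nat.cast_nonneg n)

end EntryBounds

end TwoStage

/-! ### The sample size requirement -/

section SampleSize

variable {σ γ L d K n : ℝ}

/-- The sample size in terms of the threshold `σ^(3/2) (1 - γ)` for the perturbation. The constant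
`80000 = 8 * 100 ^ 2` is chosen so that the main fluctuation is a hundredth of that threshold. -/
lemma mul_sqrt_le_of_sample_size (hσ : 0 < σ) (hγ1 : γ < 1) (hL : 0 ≤ L)
    (hK : 0 ≤ K) (hn : 0 < n)
    (h : 80000 * (d ^ 2 * K * L / (σ ^ 3 * (1 - γ) ^ 2)) ≤ n) :
    80000 * (d ^ 2 * K * L) ≤ n * (σ * √σ * (1 - γ)) ^ 2 ∧
      d * √(2 * (4 * L) * n * K) ≤ n * (σ * √σ * (1 - γ)) / 100 := by
  have h1 : 0 < 1 - γ := by linarith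
  have hs : (σ * √σ * (1 - γ)) ^ 2 = σ ^ 3 * (1 - γ) ^ 2 := by
    rw [mul_pow, mul_pow, Real.sq_sqrt hσ.le]; ring
  have hA : 80000 * (d ^ 2 * K * L) ≤ n * (σ * √σ * (1 - γ)) ^ 2 := by
    rw [hs, ← div_le_iff₀ (by positivity)]
    exact (mul_div_assoc _ _ _).le.trans h
  refine ⟨hA, ?_⟩
  refine le_of_sq_le_sq ?_ (by positivity)
  rw [mul_pow, Real.sq_sqrt (by positivity)]
  nlinarith

/-- The two smallness conditions of the perturbation argument, with the entrywise radii of `Σ̂ - Σ`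
and of `B̂ - Σ̂ T` at level `exp (-4 L)`. -/
lemma sample_size_bounds (hσ : 0 < σ) (hσ1 : σ ≤ 1) (hγ0 : 0 ≤ γ) (hγ1 : γ < 1) (hL : 0 ≤ L)
    (hd : 1 ≤ d) (hK : 1 ≤ K) (hn : 0 < n)
    (h : 80000 * (d ^ 2 * K * L / (σ ^ 3 * (1 - γ) ^ 2)) ≤ n) :
    d * ((2 * √(2 * (4 * L) * n) + 4 * √(2 * (4 * L) * n * K)) / n) ≤ σ / 2 ∧
      d * ((2 * √(2 * (4 * L) * n) + 4 * 2 * (4 * L) * K) / n) ≤ σ * √σ * (1 - γ) / 4 := by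
  have h1 : 0 < 1 - γ := by linarith
  obtain ⟨hA, hB⟩ := mul_sqrt_le_of_sample_size hσ hγ1 hL (by linarith) hn h
  set s := σ * √σ * (1 - γ) with hs
  have hsqrt : √σ ≤ 1 := Real.sqrt_le_one.2 hσ1
  have hs0 : 0 < s := by positivity
  have hsσ : s ≤ σ := by
    calc s = σ * (√σ * (1 - γ)) := by rw [hs]; ring
      _ ≤ σ * 1 := mul_le_mul_of_nonneg_left
        (mul_le_one₀ hsqrt h1.le (by linarith)) hσ.le
      _ = σ := mul_one σ
  have hmono : √(2 * (4 * L) * n) ≤ √(2 * (4 * L) * n * K) :=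
    Real.sqrt_le_sqrt (le_mul_of_one_le_right (by positivity) hK)
  have hC : d * √(2 * (4 * L) * n) ≤ n * s / 100 :=
    (mul_le_mul_of_nonneg_left hmono (by linarith)).trans hB
  have hD : 80000 * (d * K * L) ≤ n * s := by
    have e1 : d * K * L ≤ d ^ 2 * K * L := by
      have : 0 ≤ K * L := by positivity
      rw [mul_assoc, mul_assoc]
      exact mul_le_mul_of_nonneg_right (by nlinarith) this
    have e2 : n * s ^ 2 ≤ n * s := by
      have : s ^ 2 ≤ s := by nlinarith
      exact mul_le_mul_of_nonneg_left this hn.le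
    linarith
  constructor
  · rw [← mul_div_assoc, div_le_iff₀ hn]
    nlinarith
  · rw [← mul_div_assoc, div_le_iff₀ hn]
    nlinarith

/-- The radius delivered by the analysis is at most the stated error bound. -/
lemma error_radius_le {c : ℝ} (hσ : 0 < σ) (hγ1 : γ < 1) (hL : 0 ≤ L)
    (hd : 0 ≤ d) (hK : 0 ≤ K) (hn : 0 < n) (hc : 0 ≤ c) :
    1 / (1 - γ) * (√c * (4 / √σ * (√d * ((2 / (1 - γ) * √(2 * (4 * L) * n) +
      4 * (2 / (1 - γ)) * (4 * L) * K) / n)))) ≤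
    80000 * (√(c * d * L / (σ * (1 - γ) ^ 4 * n)) +
      √(c * d / (σ * (1 - γ) ^ 4)) * (K * L / n)) := by
  have h1 : 0 < 1 - γ := by linarith
  have hs : 0 < √σ := Real.sqrt_pos.2 hσ
  set R := √(c * d / (σ * (1 - γ) ^ 4)) with hR
  have hRe : R = √c * √d / (√σ * (1 - γ) ^ 2) := by
    rw [hR, Real.sqrt_div (by positivity), Real.sqrt_mul hc, Real.sqrt_mul hσ.le]
    congr 2
    rw [show (1 - γ) ^ 4 = ((1 - γ) ^ 2) ^ 2 by ring, Real.sqrt_sq (by positivity)]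
  have h2 : √(c * d * L / (σ * (1 - γ) ^ 4 * n)) = R * √(L / n) := by
    rw [hR, ← Real.sqrt_mul (by positivity)]
    congr 1
    field_simp
  have h3 : √(2 * (4 * L) * n) ≤ 3 * n * √(L / n) := by
    refine Real.sqrt_le_iff.2 ⟨by positivity, ?_⟩
    rw [mul_pow, Real.sq_sqrt (by positivity)]
    have : (3 * n) ^ 2 * (L / n) = 9 * L * n := by field_simp; ring
    rw [this]
    nlinarith [mul_nonneg hL hn.le]
  have hR0 : 0 ≤ R := Real.sqrt_nonneg _
  have e : 1 / (1 - γ) * (√c * (4 / √σ * (√d * ((2 / (1 - γ) * √(2 * (4 * L) * n) +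
      4 * (2 / (1 - γ)) * (4 * L) * K) / n)))) =
      R * (8 * (√(2 * (4 * L) * n) / n) + 128 * (K * L / n)) := by
    rw [hRe]
    field_simp
    ring
  rw [e, h2]
  have h4 : √(2 * (4 * L) * n) / n ≤ 3 * √(L / n) := by
    rw [div_le_iff₀ hn]; linarith
  have h5 : 0 ≤ √(L / n) := Real.sqrt_nonneg _
  have h6 : 0 ≤ K * L / n := by positivity
  calc R * (8 * (√(2 * (4 * L) * n) / n) + 128 * (K * L / n))
      ≤ R * (80000 * (√(L / n) + K * L / n)) := mul_le_mul_of_nonneg_left (by linarith) hR0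
    _ = _ := by ring

end SampleSize

/-! ### The error bound on the concentration event -/

namespace TwoStage

variable {S : Type u} {A : Type v} {Z : Type w} [Fintype S] [Fintype A] [Fintype Z]
  [DecidableEq S] [DecidableEq A] [DecidableEq Z]
  [MeasurableSpace S] [MeasurableSpace A] [MeasurableSpace Z]
  [DiscreteMeasurableSpace S] [DiscreteMeasurableSpace A] [DiscreteMeasurableSpace Z]
  {M : ConfoundedMDP S A} {d n : ℕ} {φ : S → A → Fin d → ℝ} {ν : S → Fin d → ℝ}
  {w θ : Fin d → ℝ} {p : Measure Z} [IsProbabilityMeasure p]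
  {ρ : Kernel Z (S × A)} [IsMarkovKernel ρ] {π : Kernel S A} [IsMarkovKernel π] {L : ℝ}
  {D : Fin n → Observation S A Z}

open ConfoundedMDP

/-- The Bellman residual controls the vector in the Euclidean norm: the maximum norm
`max |φ(s, a)ᵀ x|` lies between `√σ` times the Euclidean norm and the Euclidean norm. -/
lemma sqrt_mul_l2norm_le_residual (h : M.IsLinear φ ν w) (hσ : 0 < sigmaMin (featureCov φ p ρ))
    (x : Fin d → ℝ) : √(sigmaMin (featureCov φ p ρ)) * (1 - M.discount) * l2norm x ≤
      l2norm (x - M.discount • (transitionMatrix φ ν π *ᵥ x)) := by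
  set u := x - M.discount • (transitionMatrix φ ν π *ᵥ x) with hu
  have h1 : 0 < 1 - M.discount := by linarith [M.discount_lt_one]
  have h2 : ∀ s a, |φ s a ⬝ᵥ u| ≤ l2norm u := fun s a =>
    (abs_dotProduct_le _ _).trans
      (mul_le_of_le_one_left (l2norm_nonneg _) (h.feature_norm s a))
  have h3 := h.abs_feature_le_of_residual π h2
  have h4 := (sqrt_mul_l2norm_le hσ.le
    (sigmaMin_mul_dotProduct_le (isHermitian_featureCov (φ := φ) (p := p) (ρ := ρ)) x)).trans
    (Real.sqrt_le_sqrt (quadForm_featureCov_le h3))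
  rw [Real.sqrt_sq (div_nonneg (l2norm_nonneg _) h1.le), le_div_iff₀ h1] at h4
  linarith

lemma eq_zero_of_l2norm_nonpos {x : Fin d → ℝ} (hx : l2norm x ≤ 0) : x = 0 := by
  funext j
  exact abs_nonpos_iff.1 ((abs_apply_le_l2norm x j).trans hx)

lemma isUnit_one_sub_transitionMatrix (h : M.IsLinear φ ν w)
    (hσ : 0 < sigmaMin (featureCov φ p ρ)) :
    IsUnit (1 - M.discount • transitionMatrix φ ν π) := by
  refine isUnit_of_mulVec_eq_zero fun x hx => ?_
  rw [sub_mulVec, one_mulVec, smul_mulVec] at hx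
  have h1 := sqrt_mul_l2norm_le_residual (π := π) h hσ x
  have h0 : l2norm (0 : Fin d → ℝ) = 0 := by simp [l2norm]
  rw [hx, h0] at h1
  have h2 : 0 < √(sigmaMin (featureCov φ p ρ)) * (1 - M.discount) :=
    mul_pos (Real.sqrt_pos.2 hσ) (by linarith [M.discount_lt_one])
  exact eq_zero_of_l2norm_nonpos (nonpos_of_mul_nonpos_right h1 h2)

/-- A bound in the `Σ`-norm on a Bellman residual becomes a bound on the value at `s₀`, with the
coverage factor as the price. -/
lemma abs_policyFeature_dotProduct_le_coverage (h : M.IsLinear φ ν w)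
    (hσ : 0 < sigmaMin (featureCov φ p ρ)) (s₀ : S) (x : Fin d → ℝ) :
    |policyFeature φ π s₀ ⬝ᵥ x| ≤ 1 / (1 - M.discount) * (√(coverage M φ p ρ π s₀) *
      √((x - M.discount • (transitionMatrix φ ν π *ᵥ x)) ⬝ᵥ
        (featureCov φ p ρ *ᵥ (x - M.discount • (transitionMatrix φ ν π *ᵥ x))))) := by
  have h1 : 0 < 1 - M.discount := by linarith [M.discount_lt_one]
  have hres := h.sum_visitation_residual π s₀ x
  set u := x - M.discount • (transitionMatrix φ ν π *ᵥ x) with hu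
  have hPD := posDef_of_sigmaMin_pos (isHermitian_featureCov (φ := φ) (p := p) (ρ := ρ)) hσ
  set V : S × A → ℝ := fun y => M.visitation π s₀ y.1 y.2 with hV
  have hV0 : ∀ y, 0 ≤ V y := fun y => M.visitation_nonneg π s₀ y.1 y.2
  have hV1 : ∑ y, V y = 1 := by
    rw [Fintype.sum_prod_type]; exact M.sum_visitation π s₀
  -- Jensen's inequality for the visitation distribution
  have hjensen : (∑ y, V y * (φ y.1 y.2 ⬝ᵥ u)) ^ 2 ≤ ∑ y, V y * (φ y.1 y.2 ⬝ᵥ u) ^ 2 := by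
    have hcs := Finset.sum_mul_sq_le_sq_mul_sq Finset.univ (fun y => √(V y))
      (fun y => √(V y) * (φ y.1 y.2 ⬝ᵥ u))
    have e1 : ∀ y, √(V y) * (√(V y) * (φ y.1 y.2 ⬝ᵥ u)) = V y * (φ y.1 y.2 ⬝ᵥ u) := fun y => by
      rw [← mul_assoc, Real.mul_self_sqrt (hV0 y)]
    have e2 : ∀ y, √(V y) ^ 2 = V y := fun y => Real.sq_sqrt (hV0 y)
    simp only [e1, mul_pow, e2, hV1, one_mul] at hcs
    exact hcs
  have hle : ∑ y, V y * (φ y.1 y.2 ⬝ᵥ u) ^ 2 ≤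
      coverage M φ p ρ π s₀ * (u ⬝ᵥ (featureCov φ p ρ *ᵥ u)) := by
    have : coverage M φ p ρ π s₀ =
        ∑ y : S × A, V y * weightedNorm (featureCov φ p ρ)⁻¹ (φ y.1 y.2) ^ 2 := by
      rw [Fintype.sum_prod_type]; rfl
    rw [this, Finset.sum_mul]
    refine Finset.sum_le_sum fun y _ => ?_
    rw [mul_assoc]
    exact mul_le_mul_of_nonneg_left (sq_dotProduct_le_weightedNorm hPD _ _) (hV0 y)
  have hcov0 : 0 ≤ coverage M φ p ρ π s₀ := Finset.sum_nonneg fun s _ => Finset.sum_nonneg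
    fun a _ => mul_nonneg (M.visitation_nonneg π s₀ s a) (sq_nonneg _)
  have habs : |∑ y, V y * (φ y.1 y.2 ⬝ᵥ u)| ≤
      √(coverage M φ p ρ π s₀) * √(u ⬝ᵥ (featureCov φ p ρ *ᵥ u)) := by
    rw [← Real.sqrt_mul hcov0]
    exact Real.abs_le_sqrt (hjensen.trans hle)
  have e : policyFeature φ π s₀ ⬝ᵥ x = 1 / (1 - M.discount) * ∑ y, V y * (φ y.1 y.2 ⬝ᵥ u) := by
    rw [Fintype.sum_prod_type]
    change _ = _ * ∑ s, ∑ a, M.visitation π s₀ s a * (φ s a ⬝ᵥ u)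
    rw [hres]
    field_simp
  rw [e, abs_mul, abs_of_pos (by positivity)]
  exact mul_le_mul_of_nonneg_left habs (by positivity)

/-- On the concentration event, the estimator is well defined and satisfies the error bound. -/
theorem Concentrated.wellDefined_and_abs_sub_le (h : M.IsLinear φ ν w)
    (hσ : 0 < sigmaMin (featureCov φ p ρ)) (hL : 0 ≤ L) (hn : 0 < n) (hZ : 0 < Fintype.card Z)
    (hθ : θ - M.discount • (transitionMatrix φ ν π *ᵥ θ) = w)
    (hsize : 80000 * ((d : ℝ) ^ 2 * Fintype.card Z * L /
      (sigmaMin (featureCov φ p ρ) ^ 3 * (1 - M.discount) ^ 2)) ≤ n)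
    (hD : Concentrated φ π p ρ (transitionMatrix φ ν π) θ M.discount (4 * L) D) :
    WellDefined φ π M.discount D ∧ ∀ s₀ : S,
      |valueHat φ π M.discount D s₀ - M.value π s₀| ≤
        80000 * (√(coverage M φ p ρ π s₀ * d * L /
          (sigmaMin (featureCov φ p ρ) * (1 - M.discount) ^ 4 * n)) +
          √(coverage M φ p ρ π s₀ * d / (sigmaMin (featureCov φ p ρ) * (1 - M.discount) ^ 4)) *
            (Fintype.card Z * L / n)) := by
  have hσ1 := sigmaMin_featureCov_le_one h.feature_norm hσ
  have hd := dim_pos_of_sigmaMin_pos hσ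
  have hSig := sigmaMin_mul_dotProduct_le (isHermitian_featureCov (φ := φ) (p := p) (ρ := ρ))
  have hresid := sqrt_mul_l2norm_le_residual (p := p) (ρ := ρ) (π := π) h hσ
  have hvalue := abs_policyFeature_dotProduct_le_coverage (p := p) (ρ := ρ) (π := π) h hσ
  set Sig := featureCov φ p ρ with hSigdef
  set σ := sigmaMin Sig with hσdef
  set T := transitionMatrix φ ν π with hT
  set γ := M.discount with hγ
  have hγ0 : 0 ≤ γ := M.discount_nonneg
  have hγ1 : γ < 1 := M.discount_lt_one
  have h1γ : 0 < 1 - γ := by linarith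
  have hs : 0 < √σ := Real.sqrt_pos.2 hσ
  have hn' : (0 : ℝ) < n := by exact_mod_cast hn
  obtain ⟨hb1, hb2⟩ := sample_size_bounds hσ hσ1 hγ0 hγ1 hL (d := d) (K := Fintype.card Z)
    (by exact_mod_cast hd) (by exact_mod_cast hZ) hn' hsize
  -- `Σ̂ ≥ Σ / 2`
  have hSh : ∀ x, x ⬝ᵥ (Sig *ᵥ x) / 2 ≤ x ⬝ᵥ (sigmaHat φ D *ᵥ x) := fun x => by
    have h1 := abs_quadForm_le (by positivity)
      (hD.abs_sigmaHat_sub_le (by positivity) hn h.feature_norm) x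
    rw [sub_mulVec, dotProduct_sub] at h1
    have h2 := (abs_le.1 h1).1
    have h3 : 0 ≤ x ⬝ᵥ x := by rw [← l2norm_sq]; positivity
    have h4 := mul_le_mul_of_nonneg_right hb1 h3
    have h5 := hSig x
    linarith
  set G := bHat φ π D - sigmaHat φ D * T with hG
  have hGx : ∀ x, l2norm (G *ᵥ x) ≤
      d * ((2 * √(2 * (4 * L) * n) + 4 * 2 * (4 * L) * Fintype.card Z) / n) * l2norm x :=
    fun x => l2norm_mulVec_le (by positivity)
      (hD.abs_bHat_sub_le (by positivity)) x
  have hstab : ∀ g Δ : Fin d → ℝ, sigmaHat φ D *ᵥ (Δ - γ • (T *ᵥ Δ)) = g + γ • (G *ᵥ Δ) →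
      √((Δ - γ • (T *ᵥ Δ)) ⬝ᵥ (Sig *ᵥ (Δ - γ • (T *ᵥ Δ)))) ≤ 4 / √σ * l2norm g :=
    fun g Δ hg => sqrt_quadForm_le_of_mulVec_eq hσ hγ0 hγ1 hSig hSh hGx hb2 (hresid Δ) hg
  have hzero : l2norm (0 : Fin d → ℝ) = 0 := by simp [l2norm]
  have hU1 : IsUnit (sigmaHat φ D) := by
    refine isUnit_of_mulVec_eq_zero fun x hx => ?_
    have h1 := hSh x
    rw [hx, dotProduct_zero] at h1
    have h2 := hSig x
    have h3 : σ * l2norm x ^ 2 ≤ 0 := by rw [l2norm_sq]; linarith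
    have h4 := nonpos_of_mul_nonpos_right h3 hσ
    exact eq_zero_of_l2norm_nonpos (by nlinarith [l2norm_nonneg x])
  have hdet1 := (isUnit_iff_isUnit_det _).1 hU1
  have hShA : ∀ x, sigmaHat φ D *ᵥ (aHat φ π D *ᵥ x) = bHat φ π D *ᵥ x := fun x => by
    rw [aHat, mulVec_mulVec, mul_nonsing_inv_cancel_left _ _ hdet1]
  have hGeq : ∀ x, sigmaHat φ D *ᵥ (x - γ • (T *ᵥ x)) =
      (sigmaHat φ D *ᵥ x - γ • (bHat φ π D *ᵥ x)) + γ • (G *ᵥ x) := fun x => by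
    rw [hG, sub_mulVec, mulVec_sub, mulVec_smul, mulVec_mulVec, smul_sub]
    abel
  have hU2 : IsUnit (1 - γ • aHat φ π D) := by
    refine isUnit_of_mulVec_eq_zero fun x hx => ?_
    rw [sub_mulVec, one_mulVec, smul_mulVec] at hx
    have h1 : sigmaHat φ D *ᵥ x - γ • (bHat φ π D *ᵥ x) = 0 := by
      rw [← hShA, ← mulVec_smul, ← mulVec_sub, hx, mulVec_zero]
    have h2 := hstab 0 x (by rw [hGeq, h1])
    rw [hzero, mul_zero] at h2
    have h3 := (sqrt_mul_l2norm_le hσ.le (hSig (x - γ • (T *ᵥ x)))).trans h2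
    have h4 := (hresid x).trans (nonpos_of_mul_nonpos_right h3 hs)
    exact eq_zero_of_l2norm_nonpos (nonpos_of_mul_nonpos_right h4 (by positivity))
  have hdet2 := (isUnit_iff_isUnit_det _).1 hU2
  refine ⟨⟨hU1, hU2⟩, fun s₀ => ?_⟩
  set Δ := thetaHat φ π γ D - θ with hΔ
  have hhat : sigmaHat φ D *ᵥ thetaHat φ π γ D - γ • (bHat φ π D *ᵥ thetaHat φ π γ D) =
      tauHat φ D := by
    have h1 : (1 - γ • aHat φ π D) *ᵥ thetaHat φ π γ D = wHat φ D := by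
      rw [thetaHat, mulVec_mulVec, mul_nonsing_inv _ hdet2, one_mulVec]
    rw [sub_mulVec, one_mulVec, smul_mulVec] at h1
    rw [← hShA, ← mulVec_smul, ← mulVec_sub, h1, wHat, mulVec_mulVec, mul_nonsing_inv _ hdet1,
      one_mulVec]
  set g := tauHat φ D + γ • (bHat φ π D *ᵥ θ) - sigmaHat φ D *ᵥ θ with hg
  have hΔeq : sigmaHat φ D *ᵥ (Δ - γ • (T *ᵥ Δ)) = g + γ • (G *ᵥ Δ) := by
    rw [hGeq, hg, ← hhat, hΔ, mulVec_sub, mulVec_sub, smul_sub]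
    congr 1
    abel
  have hgl := l2norm_le_of_abs_le (by positivity) (hD.abs_tauHat_add_sub_le (by positivity) hγ1)
  have hV : valueHat φ π γ D s₀ - M.value π s₀ = policyFeature φ π s₀ ⬝ᵥ Δ := by
    rw [h.value_eq π s₀ hθ, valueHat, ← dotProduct_sub]
  have hcov0 : 0 ≤ coverage M φ p ρ π s₀ := Finset.sum_nonneg fun s _ => Finset.sum_nonneg
    fun a _ => mul_nonneg (M.visitation_nonneg π s₀ s a) (sq_nonneg _)
  rw [hV]
  refine ((hvalue s₀ Δ).trans ?_).trans (error_radius_le (d := d) (K := Fintype.card Z)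
    hσ hγ1 hL (Nat.cast_nonneg d) (Nat.cast_nonneg _) hn' hcov0)
  refine mul_le_mul_of_nonneg_left (mul_le_mul_of_nonneg_left ?_ (Real.sqrt_nonneg _))
    (by positivity)
  exact (hstab g Δ hΔeq).trans (mul_le_mul_of_nonneg_left hgl (by positivity))

end TwoStage

/-! ### Conditionally centered observables of one sample -/

namespace ConfoundedMDP

variable {S : Type u} {A : Type v} {Z : Type w} [Fintype S] [Fintype A] [Fintype Z]
  [MeasurableSpace S] [MeasurableSpace A] [MeasurableSpace Z]
  [DiscreteMeasurableSpace S] [DiscreteMeasurableSpace A] [DiscreteMeasurableSpace Z]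
  {M : ConfoundedMDP S A} {d : ℕ} {φ : S → A → Fin d → ℝ} {ν : S → Fin d → ℝ}
  {w θ : Fin d → ℝ} {p : Measure Z} [IsProbabilityMeasure p]
  {ρ : Kernel Z (S × A)} [IsMarkovKernel ρ] {π : Kernel S A} [IsMarkovKernel π]

instance : IsProbabilityMeasure (M.sampleLaw p ρ) := by
  unfold sampleLaw; infer_instance

instance (n : ℕ) : IsProbabilityMeasure (M.datasetLaw p ρ n) := by
  unfold datasetLaw; infer_instance

lemma abs_confounder_le_one : ∀ᵐ o ∂(M.sampleLaw p ρ), |o.2.1| ≤ 1 := by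
  have hms : MeasurableSet {o : (Z × S × A) × ℝ × S | |o.2.1| ≤ 1} :=
    measurableSet_le (by fun_prop) (by fun_prop)
  refine (Measure.ae_compProd_iff hms).2 (Filter.Eventually.of_forall fun x => ?_)
  rw [Kernel.prodMkLeft_apply, Kernel.prod_apply]
  have h1 : ∀ᵐ e ∂(M.confounder x.2), |e| ≤ 1 :=
    (M.confounder_mem x.2).mono fun e he => abs_le.2 (M.confounderSpace_subset he)
  exact Measure.quasiMeasurePreserving_fst.ae h1

/-- An observable that is centered given `(z, s, a)` is centered on every set `{z = const}`. -/
lemma setIntegral_sampleLaw_eq_zero_of_next {f : (Z × S × A) × ℝ × S → ℝ}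
    (hf : Integrable f (M.sampleLaw p ρ))
    (h0 : ∀ x, ∫ y, f (x, y) ∂((M.confounder x.2).prod (M.transition x.2)) = 0) (z : Z) :
    ∫ o in (fun o => o.1.1) ⁻¹' {z}, f o ∂(M.sampleLaw p ρ) = 0 := by
  have hset : (fun o : (Z × S × A) × ℝ × S => o.1.1) ⁻¹' {z} =
      ((Prod.fst ⁻¹' {z} : Set (Z × S × A)) ×ˢ (Set.univ : Set (ℝ × S))) := by
    ext o; simp
  rw [hset, sampleLaw, Measure.setIntegral_compProd (measurable_fst (measurableSet_singleton z))
    MeasurableSet.univ (Integrable.integrableOn hf)]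
  simp [Kernel.prodMkLeft_apply, Kernel.prod_apply, h0]

/-- A function of `(z, s, a)` that is centered given `z` is centered on every set `{z = const}`. -/
lemma setIntegral_sampleLaw_eq_zero_of_pair {g : Z × S × A → ℝ}
    (h0 : ∀ z, ∫ y, g (z, y) ∂(ρ z) = 0) (z : Z) :
    ∫ o in (fun o => o.1.1) ⁻¹' {z}, g o.1 ∂(M.sampleLaw p ρ) = 0 := by
  have hset : (fun o : (Z × S × A) × ℝ × S => o.1.1) ⁻¹' {z} =
      ((({z} : Set Z) ×ˢ (Set.univ : Set (S × A))) ×ˢ (Set.univ : Set (ℝ × S))) := by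
    ext o; simp
  have hint : Integrable (fun o : (Z × S × A) × ℝ × S => g o.1) (M.sampleLaw p ρ) :=
    Integrable.of_bound (Measurable.of_discrete.comp measurable_fst).aestronglyMeasurable
      (∑ x, ‖g x‖) (Filter.Eventually.of_forall fun o =>
        Finset.single_le_sum (f := fun x => ‖g x‖) (fun _ _ => norm_nonneg _)
          (Finset.mem_univ o.1))
  rw [hset, sampleLaw, Measure.setIntegral_compProd
    ((measurableSet_singleton z).prod MeasurableSet.univ) MeasurableSet.univ hint.integrableOn]
  simp only [Measure.restrict_univ, integral_const, probReal_univ, one_smul]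
  rw [Measure.setIntegral_compProd (measurableSet_singleton z) MeasurableSet.univ
    (Integrable.of_finite.integrableOn)]
  simp [h0]

lemma integral_sampleLaw_instr (g : Z → ℝ) :
    ∫ o, g o.1.1 ∂(M.sampleLaw p ρ) = ∑ z, p.real {z} * g z := by
  have hfst : (M.sampleLaw p ρ).map (fun o => o.1.1) = p := by
    have e : (fun o : (Z × S × A) × ℝ × S => o.1.1) = Prod.fst ∘ Prod.fst := rfl
    rw [e, ← Measure.map_map measurable_fst measurable_fst]
    change ((M.sampleLaw p ρ).fst).fst = p
    rw [sampleLaw, Measure.fst_compProd, Measure.fst_compProd]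
  have := integral_map (μ := M.sampleLaw p ρ) (φ := fun o => o.1.1)
    (Measurable.aemeasurable (by fun_prop)) (f := g) Measurable.of_discrete.aestronglyMeasurable
  rw [← this, hfst, integral_fintype Integrable.of_finite]
  simp

lemma IsInstrument.setIntegral_confounder (h : M.IsInstrument p ρ) (z : Z) :
    ∫ o in (fun o => o.1.1) ⁻¹' {z}, o.2.1 ∂(M.sampleLaw p ρ) = 0 := by
  have hm : MeasurableSpace.comap (fun o : (Z × S × A) × ℝ × S => o.1.1) inferInstance ≤
      (inferInstance : MeasurableSpace ((Z × S × A) × ℝ × S)) :=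
    Measurable.comap_le (by fun_prop)
  have hint : Integrable (fun o : (Z × S × A) × ℝ × S => o.2.1) (M.sampleLaw p ρ) :=
    Integrable.of_bound (Measurable.aestronglyMeasurable (by fun_prop)) 1 abs_confounder_le_one
  rw [← setIntegral_condExp hm hint ⟨{z}, measurableSet_singleton z, rfl⟩]
  exact (integral_congr_ae (ae_restrict_of_ae h)).trans (by simp)

lemma abs_nextError_le (h : M.IsLinear φ ν w) (o : Observation S A Z) (k : Fin d) :
    |TwoStage.nextError φ π (transitionMatrix φ ν π) o k| ≤ 2 := by
  have h1 : ∀ s a, |φ s a ⬝ᵥ Pi.single k 1| ≤ 1 := fun s a => by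
    simpa using (abs_apply_le_l2norm _ k).trans (h.feature_norm s a)
  have h2 := abs_policyFeature_dotProduct_le π (h1 o.next)
  have h3 := h.abs_feature_transitionMatrix_le π h1 o.state o.action
  rw [dotProduct_mulVec, dotProduct_single_one] at h3
  rw [dotProduct_single_one] at h2
  rw [TwoStage.nextError, Pi.sub_apply]
  exact (abs_sub _ _).trans (by linarith)

lemma IsLinear.abs_feature_dotProduct_le_of_bellman (h : M.IsLinear φ ν w)
    (hθ : θ - M.discount • (transitionMatrix φ ν π *ᵥ θ) = w) (s : S) (a : A) :
    |φ s a ⬝ᵥ θ| ≤ 1 / (1 - M.discount) := by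
  refine h.abs_feature_le_of_residual π (fun s a => ?_) s a
  rw [hθ]
  exact (abs_dotProduct_le _ _).trans
    (mul_le_one₀ (h.feature_norm s a) (l2norm_nonneg _) h.weight_norm)

/-- For the weight of the value function, the temporal-difference error is the confounder plus the
discounted prediction error of the next value. -/
lemma IsLinear.tdError_observe (h : M.IsLinear φ ν w)
    (hθ : θ - M.discount • (transitionMatrix φ ν π *ᵥ θ) = w) (o : (Z × S × A) × ℝ × S) :
    TwoStage.tdError φ π M.discount θ (M.observe o) = o.2.1 + M.discount *
      (TwoStage.nextError φ π (transitionMatrix φ ν π) (M.observe o) ⬝ᵥ θ) := by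
  have h1 : φ o.1.2.1 o.1.2.2 ⬝ᵥ θ = M.reward o.1.2.1 o.1.2.2 +
      M.discount * (φ o.1.2.1 o.1.2.2 ⬝ᵥ (transitionMatrix φ ν π *ᵥ θ)) := by
    rw [h.reward_eq]
    have e := congrArg (fun y => φ o.1.2.1 o.1.2.2 ⬝ᵥ y) hθ
    simp only [dotProduct_sub, dotProduct_smul, smul_eq_mul] at e
    linarith
  simp only [TwoStage.tdError, TwoStage.nextError, observe, sub_dotProduct, ← dotProduct_mulVec]
  rw [h1]
  ring

lemma abs_tdError_le (h : M.IsLinear φ ν w)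
    (hθ : θ - M.discount • (transitionMatrix φ ν π *ᵥ θ) = w) :
    ∀ᵐ o ∂(M.sampleLaw p ρ), |TwoStage.tdError φ π M.discount θ (M.observe o)| ≤
      2 / (1 - M.discount) := by
  have h0 := M.discount_nonneg
  have h1 : 0 < 1 - M.discount := by linarith [M.discount_lt_one]
  have hb := h.abs_feature_dotProduct_le_of_bellman hθ
  filter_upwards [abs_confounder_le_one (M := M) (p := p) (ρ := ρ)] with o ho
  rw [h.tdError_observe hθ, TwoStage.nextError, sub_dotProduct, ← dotProduct_mulVec]
  have h2 := abs_policyFeature_dotProduct_le π (hb o.2.2)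
  have h3 := h.abs_feature_transitionMatrix_le π hb o.1.2.1 o.1.2.2
  have h4 : |M.discount * (policyFeature φ π (M.observe o).next ⬝ᵥ θ -
      φ (M.observe o).state (M.observe o).action ⬝ᵥ (transitionMatrix φ ν π *ᵥ θ))| ≤
      M.discount * (1 / (1 - M.discount) + 1 / (1 - M.discount)) := by
    rw [abs_mul, abs_of_nonneg h0]
    exact mul_le_mul_of_nonneg_left ((abs_sub _ _).trans (add_le_add h2 h3)) h0
  refine (abs_add_le _ _).trans ((add_le_add ho h4).trans ?_)
  rw [← sub_nonneg]
  have e : 2 / (1 - M.discount) - (1 + M.discount * (1 / (1 - M.discount) +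
      1 / (1 - M.discount))) = 1 := by
    field_simp
    ring
  rw [e]
  norm_num

lemma measurable_nextError (T : Matrix (Fin d) (Fin d) ℝ) (k : Fin d) :
    Measurable fun o : (Z × S × A) × ℝ × S => TwoStage.nextError φ π T (M.observe o) k :=
  (Measurable.of_discrete (f := fun y : (S × A) × S =>
    policyFeature φ π y.2 k - (φ y.1.1 y.1.2 ᵥ* T) k)).comp
    (g := fun y : (S × A) × S => policyFeature φ π y.2 k - (φ y.1.1 y.1.2 ᵥ* T) k)
    (f := fun o : (Z × S × A) × ℝ × S => (o.1.2, o.2.2)) (by fun_prop)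

lemma measurable_tdError (h : M.IsLinear φ ν w)
    (hθ : θ - M.discount • (transitionMatrix φ ν π *ᵥ θ) = w) :
    Measurable fun o : (Z × S × A) × ℝ × S =>
      TwoStage.tdError φ π M.discount θ (M.observe o) := by
  simp_rw [h.tdError_observe hθ, dotProduct]
  have := fun k => measurable_nextError (Z := Z) (M := M) (φ := φ) (π := π)
    (transitionMatrix φ ν π) k
  exact (by fun_prop : Measurable fun o : (Z × S × A) × ℝ × S => o.2.1).add
    ((Finset.measurable_fun_sum _ fun k _ => (this k).mul_const _).const_mul _)

lemma setIntegral_nextError (h : M.IsLinear φ ν w) (k : Fin d) (z : Z) :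
    ∫ o in (fun o => o.1.1) ⁻¹' {z},
      TwoStage.nextError φ π (transitionMatrix φ ν π) (M.observe o) k ∂(M.sampleLaw p ρ) = 0 := by
  refine setIntegral_sampleLaw_eq_zero_of_next
    (Integrable.of_bound (measurable_nextError _ k).aestronglyMeasurable 2
      (Filter.Eventually.of_forall fun o => abs_nextError_le h _ k)) (fun x => ?_) z
  have h1 := h.feature_dotProduct_transitionMatrix π x.2.1 x.2.2 (Pi.single k 1)
  rw [dotProduct_mulVec, dotProduct_single_one] at h1
  have h2 : ∀ y : ℝ × S, TwoStage.nextError φ π (transitionMatrix φ ν π) (M.observe (x, y)) k =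
      (fun s => policyFeature φ π s k - (φ x.2.1 x.2.2 ᵥ* transitionMatrix φ ν π) k) y.2 :=
    fun y => rfl
  simp_rw [h2]
  rw [integral_fun_snd (f := fun s => policyFeature φ π s k -
    (φ x.2.1 x.2.2 ᵥ* transitionMatrix φ ν π) k),
    integral_sub Integrable.of_finite Integrable.of_finite,
    integral_fintype Integrable.of_finite, h1]
  simp

lemma setIntegral_tdError (h : M.IsLinear φ ν w) (hinstr : M.IsInstrument p ρ)
    (hθ : θ - M.discount • (transitionMatrix φ ν π *ᵥ θ) = w) (z : Z) :
    ∫ o in (fun o => o.1.1) ⁻¹' {z},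
      TwoStage.tdError φ π M.discount θ (M.observe o) ∂(M.sampleLaw p ρ) = 0 := by
  simp_rw [h.tdError_observe hθ, dotProduct]
  have hint1 : Integrable (fun o : (Z × S × A) × ℝ × S => o.2.1) (M.sampleLaw p ρ) :=
    Integrable.of_bound (Measurable.aestronglyMeasurable (by fun_prop)) 1 abs_confounder_le_one
  have hint2 : ∀ k, Integrable (fun o : (Z × S × A) × ℝ × S =>
      TwoStage.nextError φ π (transitionMatrix φ ν π) (M.observe o) k * θ k)
      (M.sampleLaw p ρ) := fun k =>
    (Integrable.of_bound (measurable_nextError _ k).aestronglyMeasurable 2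
      (Filter.Eventually.of_forall fun o => abs_nextError_le h _ k)).mul_const _
  rw [integral_add hint1.integrableOn
    ((integrable_finsetSum _ fun k _ => hint2 k).const_mul _).integrableOn,
    hinstr.setIntegral_confounder, integral_const_mul,
    integral_finsetSum _ fun k _ => (hint2 k).integrableOn]
  simp [integral_mul_const, setIntegral_nextError h]

lemma setIntegral_feature_sub_condFeature (j : Fin d) (z : Z) :
    ∫ o in (fun o => o.1.1) ⁻¹' {z},
      (φ o.1.2.1 o.1.2.2 j - condFeature φ ρ o.1.1 j) ∂(M.sampleLaw p ρ) = 0 := by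
  refine setIntegral_sampleLaw_eq_zero_of_pair
    (g := fun x => φ x.2.1 x.2.2 j - condFeature φ ρ x.1 j) (fun z => ?_) z
  change ∫ y : S × A, (φ y.1 y.2 j - condFeature φ ρ z j) ∂(ρ z) = 0
  rw [integral_sub Integrable.of_finite Integrable.of_finite,
    integral_fintype Integrable.of_finite, condFeature_apply]
  simp

/-! ### Concentration of the dataset -/

section Dataset

variable [DecidableEq Z] {n : ℕ} {x b : ℝ} {f : (Z × S × A) × ℝ × S → ℝ}

lemma measureReal_lt_abs_groupSum_le (hx : 0 ≤ x) (hb : 0 < b) (hf : Measurable f)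
    (hfb : ∀ᵐ o ∂(M.sampleLaw p ρ), |f o| ≤ b)
    (h0 : ∀ z, ∫ o in (fun o => o.1.1) ⁻¹' {z}, f o ∂(M.sampleLaw p ρ) = 0) (z : Z) :
    (M.datasetLaw p ρ n).real {ω | b * √(2 * x *
      TwoStage.instrCount (fun i => M.observe (ω i)) z) <
        |TwoStage.groupSum (fun i => M.observe (ω i)) (fun i => f (ω i)) z|} ≤
      2 * Real.exp (-x) := by
  have h := measureReal_lt_abs_weighted_sum_le (n := n) (μ := M.sampleLaw p ρ)
    (ζ := fun o => o.1.1) (by fun_prop) hf hb hfb h0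
    (fun y i => if y i = z then 1 else 0) hx
  refine (le_of_eq ?_).trans h
  have e1 : ∀ ω : Fin n → (Z × S × A) × ℝ × S,
      TwoStage.instrCount (fun i => M.observe (ω i)) z =
        ∑ i, (if (ω i).1.1 = z then (1 : ℝ) else 0) ^ 2 := fun ω =>
    Finset.sum_congr rfl fun i _ => by by_cases hi : (ω i).1.1 = z <;> simp [observe, hi]
  have e2 : ∀ ω : Fin n → (Z × S × A) × ℝ × S,
      TwoStage.groupSum (fun i => M.observe (ω i)) (fun i => f (ω i)) z =
        ∑ i, (if (ω i).1.1 = z then (1 : ℝ) else 0) * f (ω i) := fun ω =>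
    Finset.sum_congr rfl fun i _ => by by_cases hi : (ω i).1.1 = z <;> simp [observe, hi]
  simp_rw [e1, e2]
  rfl

lemma measureReal_lt_abs_sum_mul_le (hx : 0 ≤ x) (hb : 0 < b) (hf : Measurable f)
    (hfb : ∀ᵐ o ∂(M.sampleLaw p ρ), |f o| ≤ b)
    (h0 : ∀ z, ∫ o in (fun o => o.1.1) ⁻¹' {z}, f o ∂(M.sampleLaw p ρ) = 0)
    {Ψ : Z → ℝ} (hΨ : ∀ z, |Ψ z| ≤ 1) :
    (M.datasetLaw p ρ n).real {ω | b * √(2 * x * n) <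
        |∑ i, Ψ (M.observe (ω i)).instr * f (ω i)|} ≤ 2 * Real.exp (-x) := by
  have h := measureReal_lt_abs_weighted_sum_le (n := n) (μ := M.sampleLaw p ρ)
    (ζ := fun o => o.1.1) (by fun_prop) hf hb hfb h0 (fun y i => Ψ (y i)) hx
  refine (measureReal_mono (μ := M.datasetLaw p ρ n) fun ω hω => ?_).trans h
  refine lt_of_le_of_lt (mul_le_mul_of_nonneg_left (Real.sqrt_le_sqrt ?_) hb.le) hω
  refine mul_le_mul_of_nonneg_left ?_ (by positivity)
  calc ∑ i, Ψ (ω i).1.1 ^ 2 ≤ ∑ _i : Fin n, (1 : ℝ) :=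
        Finset.sum_le_sum fun i _ => (sq_le_one_iff_abs_le_one _).2 (hΨ _)
    _ = n := by simp

lemma measureReal_lt_abs_cov_le (hx : 0 ≤ x) (hφ : ∀ s a, l2norm (φ s a) ≤ 1) (j k : Fin d) :
    (M.datasetLaw p ρ n).real {ω | 2 * √(2 * x * n) <
      |∑ i, (condFeature φ ρ (M.observe (ω i)).instr j *
        condFeature φ ρ (M.observe (ω i)).instr k - featureCov φ p ρ j k)|} ≤
      2 * Real.exp (-x) := by
  have hψ : ∀ z, |condFeature φ ρ z j * condFeature φ ρ z k| ≤ 1 := fun z => by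
    rw [abs_mul]
    exact mul_le_one₀ (abs_condFeature_le_one hφ z j) (abs_nonneg _)
      (abs_condFeature_le_one hφ z k)
  have hcov : |featureCov φ p ρ j k| ≤ 1 := by
    rw [featureCov_apply]
    calc _ ≤ ∑ z, |p.real {z} * (condFeature φ ρ z j * condFeature φ ρ z k)| :=
          Finset.abs_sum_le_sum_abs _ _
      _ ≤ ∑ z, p.real {z} := Finset.sum_le_sum fun z _ => by
          rw [abs_mul, abs_of_nonneg measureReal_nonneg]
          exact mul_le_of_le_one_right measureReal_nonneg (hψ z)
      _ = 1 := by rw [sum_measureReal_singleton]; simp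
  have hm : Measurable fun o : (Z × S × A) × ℝ × S =>
      condFeature φ ρ o.1.1 j * condFeature φ ρ o.1.1 k - featureCov φ p ρ j k :=
    (Measurable.of_discrete (f := fun z =>
      condFeature φ ρ z j * condFeature φ ρ z k - featureCov φ p ρ j k)).comp
      (g := fun z => condFeature φ ρ z j * condFeature φ ρ z k - featureCov φ p ρ j k)
      (f := fun o : (Z × S × A) × ℝ × S => o.1.1) (by fun_prop)
  -- the covariate is trivial here: these summands are centered, but not conditionally on `z`
  have h := measureReal_lt_abs_weighted_sum_le (n := n) (μ := M.sampleLaw p ρ)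
    (ζ := fun _ => ()) (by fun_prop) hm two_pos (Filter.Eventually.of_forall fun o =>
      (abs_sub _ _).trans (by linarith [hψ o.1.1])) (fun _ => by
        have hu : (fun _ : (Z × S × A) × ℝ × S => ()) ⁻¹' {()} = Set.univ := by ext; simp
        rw [hu, Measure.restrict_univ, integral_sampleLaw_instr (g := fun z =>
          condFeature φ ρ z j * condFeature φ ρ z k - featureCov φ p ρ j k)]
        simp_rw [mul_sub]
        rw [Finset.sum_sub_distrib, ← featureCov_apply, ← Finset.sum_mul,
          sum_measureReal_singleton]
        simp) (fun _ _ => 1) hx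
  simpa [datasetLaw, observe] using h

end Dataset

end ConfoundedMDP

/-! ### The union bound -/

section UnionBound

lemma measureReal_exists_le {Ω ι : Type*} [MeasurableSpace Ω] [Fintype ι] {μ : Measure Ω}
    [IsProbabilityMeasure μ] {P : ι → Ω → Prop} {c : ℝ} (h : ∀ i, μ.real {ω | P i ω} ≤ c) :
    μ.real {ω | ∃ i, P i ω} ≤ Fintype.card ι * c := by
  have e : {ω | ∃ i, P i ω} = ⋃ i, {ω | P i ω} := by ext ω; simp
  rw [e]
  refine (measureReal_iUnion_fintype_le _).trans ((Finset.sum_le_sum fun i _ => h i).trans_eq ?_)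
  simp

/-- The total probability of the exceptional events, each of probability at most `2 exp (-4 L)`. -/
lemma card_mul_exp_neg_logFactor_le {d cS cA cZ : ℕ} (hd : 0 < d) (hS : 0 < cS) (hA : 0 < cA)
    (hZ : 0 < cZ) {δ : ℝ} (hδ0 : 0 < δ) (hδ1 : δ < 1) :
    0 < logFactor d cS cA cZ δ ∧
      (2 * (d * d : ℝ) + 2 * (cZ * d) + cZ + d) *
        (2 * Real.exp (-(4 * logFactor d cS cA cZ δ))) ≤ δ := by
  have hd' : (1 : ℝ) ≤ d := by exact_mod_cast hd
  have hS' : (1 : ℝ) ≤ cS := by exact_mod_cast hS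
  have hA' : (1 : ℝ) ≤ cA := by exact_mod_cast hA
  have hZ' : (1 : ℝ) ≤ cZ := by exact_mod_cast hZ
  set y : ℝ := 2 * d * cS * cA * cZ / δ with hy
  have hdz : 1 ≤ (d * cZ : ℝ) := one_le_mul_of_one_le_of_one_le hd' hZ'
  have hnum : 2 * (d * cZ : ℝ) ≤ 2 * d * cS * cA * cZ := by
    have : 1 ≤ (cS * cA : ℝ) := one_le_mul_of_one_le_of_one_le hS' hA'
    calc 2 * (d * cZ : ℝ) ≤ 2 * (d * cZ : ℝ) * (cS * cA) :=
          le_mul_of_one_le_right (by positivity) this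
      _ = _ := by ring
  have hyd : 2 * (d * cZ : ℝ) ≤ y * δ := by
    rw [hy, div_mul_cancel₀ _ hδ0.ne']; exact hnum
  have hyd' : 2 * (d * cZ : ℝ) ≤ y := by
    rw [hy, le_div_iff₀ hδ0]
    exact (mul_le_of_le_one_right (by positivity) hδ1.le).trans hnum
  have hy2 : 2 ≤ y := by linarith
  have hy0 : 0 < y := by linarith
  have hlog : logFactor d cS cA cZ δ = Real.log y := rfl
  refine ⟨by rw [hlog]; exact Real.log_pos (by linarith), ?_⟩
  have hexp : Real.exp (-(4 * logFactor d cS cA cZ δ)) = (y ^ 4)⁻¹ := by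
    rw [hlog, Real.exp_neg, show 4 * Real.log y = ((4 : ℕ) : ℝ) * Real.log y by norm_num,
      Real.exp_nat_mul, Real.exp_log hy0]
  rw [hexp, ← div_eq_mul_inv, mul_div, div_le_iff₀ (by positivity)]
  have hsq : (d * cZ : ℝ) ≤ (d * cZ) ^ 2 := by nlinarith
  have hdd : (d * d : ℝ) ≤ (d * cZ) ^ 2 := by
    rw [mul_pow, sq (d : ℝ)]
    exact le_mul_of_one_le_right (by positivity) (one_le_pow₀ hZ')
  have hz : (cZ : ℝ) ≤ (d * cZ) ^ 2 :=
    (le_mul_of_one_le_left (by positivity) hd').trans hsq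
  have hdl : (d : ℝ) ≤ (d * cZ) ^ 2 :=
    (le_mul_of_one_le_right (by positivity) hZ').trans hsq
  have hy3 : 8 * (d * cZ : ℝ) ≤ y ^ 3 := by
    have : (2 : ℝ) ^ 2 ≤ y ^ 2 := pow_le_pow_left₀ (by norm_num) hy2 2
    nlinarith
  calc (2 * (d * d : ℝ) + 2 * (cZ * d) + cZ + d) * 2 ≤ 12 * (d * cZ) ^ 2 := by
        rw [mul_comm (cZ : ℝ) d]; linarith
    _ ≤ (8 * (d * cZ)) * (2 * (d * cZ)) := by nlinarith
    _ ≤ y ^ 3 * (y * δ) := mul_le_mul hy3 hyd (by positivity) (by positivity)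
    _ = δ * y ^ 4 := by ring

end UnionBound

namespace ConfoundedMDP

variable {S : Type u} {A : Type v} {Z : Type w} [Fintype S] [Fintype A] [Fintype Z]
  [DecidableEq S] [DecidableEq A] [DecidableEq Z]
  [MeasurableSpace S] [MeasurableSpace A] [MeasurableSpace Z]
  [DiscreteMeasurableSpace S] [DiscreteMeasurableSpace A] [DiscreteMeasurableSpace Z]
  {M : ConfoundedMDP S A} {d n : ℕ} {φ : S → A → Fin d → ℝ} {ν : S → Fin d → ℝ}
  {w θ : Fin d → ℝ} {p : Measure Z} [IsProbabilityMeasure p]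
  {ρ : Kernel Z (S × A)} [IsMarkovKernel ρ] {π : Kernel S A} [IsMarkovKernel π]

/-- The number of exceptional events is counted by the index sets of `TwoStage.Concentrated`. -/
lemma measureReal_not_concentrated_le (h : M.IsLinear φ ν w) (hinstr : M.IsInstrument p ρ)
    (hθ : θ - M.discount • (transitionMatrix φ ν π *ᵥ θ) = w) {x : ℝ} (hx : 0 ≤ x) :
    (M.datasetLaw p ρ n).real {ω | ¬ TwoStage.Concentrated φ π p ρ (transitionMatrix φ ν π) θ
      M.discount x fun i => M.observe (ω i)} ≤
      (2 * (d * d : ℝ) + 2 * (Fintype.card Z * d) + Fintype.card Z + d) *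
        (2 * Real.exp (-x)) := by
  have h1 : 0 < 1 - M.discount := by linarith [M.discount_lt_one]
  have hψ := abs_condFeature_le_one (ρ := ρ) h.feature_norm
  have hmf : ∀ j, Measurable fun o : (Z × S × A) × ℝ × S =>
      φ o.1.2.1 o.1.2.2 j - condFeature φ ρ o.1.1 j := fun j =>
    (Measurable.of_discrete (f := fun y : Z × S × A =>
      φ y.2.1 y.2.2 j - condFeature φ ρ y.1 j)).comp measurable_fst
  have hbf : ∀ j, ∀ᵐ o ∂(M.sampleLaw p ρ),
      |φ o.1.2.1 o.1.2.2 j - condFeature φ ρ o.1.1 j| ≤ 2 := fun j =>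
    Filter.Eventually.of_forall fun o => (abs_sub _ _).trans (by
      linarith [hψ o.1.1 j, (abs_apply_le_l2norm (φ o.1.2.1 o.1.2.2) j).trans
        (h.feature_norm o.1.2.1 o.1.2.2)])
  have hbn : ∀ k, ∀ᵐ o ∂(M.sampleLaw p ρ),
      |TwoStage.nextError φ π (transitionMatrix φ ν π) (M.observe o) k| ≤ 2 := fun k =>
    Filter.Eventually.of_forall fun o => abs_nextError_le h _ k
  have hbt : (0 : ℝ) < 2 / (1 - M.discount) := by positivity
  have e1 := measureReal_exists_le fun jk : Fin d × Fin d =>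
    measureReal_lt_abs_cov_le (M := M) (p := p) (ρ := ρ) (n := n) hx h.feature_norm jk.1 jk.2
  have e2 := measureReal_exists_le fun zj : Z × Fin d =>
    measureReal_lt_abs_groupSum_le (n := n) hx two_pos (hmf zj.2) (hbf zj.2)
      (setIntegral_feature_sub_condFeature (M := M) (p := p) zj.2) zj.1
  have e3 := measureReal_exists_le fun z : Z =>
    measureReal_lt_abs_groupSum_le (n := n) hx hbt (measurable_tdError h hθ)
      (abs_tdError_le h hθ) (setIntegral_tdError h hinstr hθ) z
  have e4 := measureReal_exists_le fun j : Fin d =>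
    measureReal_lt_abs_sum_mul_le (n := n) hx hbt (measurable_tdError h hθ)
      (abs_tdError_le h hθ) (setIntegral_tdError h hinstr hθ) (hψ · j)
  have e5 := measureReal_exists_le fun zk : Z × Fin d =>
    measureReal_lt_abs_groupSum_le (n := n) hx two_pos (measurable_nextError _ zk.2) (hbn zk.2)
      (setIntegral_nextError h zk.2) zk.1
  have e6 := measureReal_exists_le fun jk : Fin d × Fin d =>
    measureReal_lt_abs_sum_mul_le (n := n) hx two_pos (measurable_nextError _ jk.2) (hbn jk.2)
      (setIntegral_nextError h jk.2) (hψ · jk.1)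
  refine (measureReal_mono (μ := M.datasetLaw p ρ n) (fun ω hω => ?_)).trans
    ((measureReal_union_le _ _).trans ((add_le_add e1
    ((measureReal_union_le _ _).trans (add_le_add e2
    ((measureReal_union_le _ _).trans (add_le_add e3
    ((measureReal_union_le _ _).trans (add_le_add e4
    ((measureReal_union_le _ _).trans (add_le_add e5 e6))))))))).trans_eq ?_))
  · by_contra hgood
    simp only [Set.mem_union, Set.mem_ofPred_eq, not_or, not_exists, not_lt, Prod.forall] at hgood
    obtain ⟨g1, g2, g3, g4, g5, g6⟩ := hgood
    refine hω ⟨g1, fun z j => ?_, g3, g4, g5, g6⟩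
    refine le_trans (le_of_eq ?_) (g2 z j)
    congr 1
    refine Finset.sum_congr rfl fun i _ => ?_
    split_ifs with hi
    · rw [← hi]; rfl
    · rfl
  · simp only [Fintype.card_prod, Fintype.card_fin, Nat.cast_mul]
    ring

end ConfoundedMDP

theorem mainTheorem1 :
    ∃ C : ℝ, 0 < C ∧
      ∀ (S : Type u) (A : Type v) (Z : Type w) [Fintype S] [Fintype A] [Fintype Z]
        [DecidableEq S] [DecidableEq A] [DecidableEq Z]
        [MeasurableSpace S] [MeasurableSpace A] [MeasurableSpace Z]
        [DiscreteMeasurableSpace S] [DiscreteMeasurableSpace A] [DiscreteMeasurableSpace Z]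
        (M : ConfoundedMDP S A) (d : ℕ) (φ : S → A → Fin d → ℝ) (ν : S → Fin d → ℝ)
        (w : Fin d → ℝ) (p : Measure Z) [IsProbabilityMeasure p]
        (ρ : Kernel Z (S × A)) [IsMarkovKernel ρ] (π : Kernel S A) [IsMarkovKernel π]
        (n : ℕ) (γ σ δ L : ℝ),
        M.IsLinear φ ν w →
        M.IsInstrument p ρ →
        γ = M.discount →
        σ = sigmaMin (featureCov φ p ρ) →
        0 < σ →
        0 < δ → δ < 1 →
        L = logFactor d (Fintype.card S) (Fintype.card A) (Fintype.card Z) δ →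
        C * (d ^ 2 * Fintype.card Z * L / (σ ^ 3 * (1 - γ) ^ 2)) ≤ n →
        1 - δ ≤ (M.datasetLaw p ρ n).real
          {ω | TwoStage.WellDefined φ π γ (fun i => M.observe (ω i)) ∧
            ∀ s₀ : S,
              |TwoStage.valueHat φ π γ (fun i => M.observe (ω i)) s₀ - M.value π s₀| ≤
                C * (Real.sqrt (coverage M φ p ρ π s₀ * d * L / (σ * (1 - γ) ^ 4 * n)) +
                  Real.sqrt (coverage M φ p ρ π s₀ * d / (σ * (1 - γ) ^ 4)) *
                    (Fintype.card Z * L / n))} := by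
  refine ⟨80000, by norm_num, ?_⟩
  intro S A Z _ _ _ _ _ _ _ _ _ _ _ _ M d φ ν w p _ ρ _ π _ n γ σ δ L hlin hinstr hγ hσ hσ0
    hδ0 hδ1 hL hn
  subst hγ hσ
  have hdZ : Nonempty Z := nonempty_of_isProbabilityMeasure p
  have hSA : Nonempty (S × A) := nonempty_of_isProbabilityMeasure (ρ hdZ.some)
  have hS : Nonempty S := ⟨hSA.some.1⟩
  have hA : Nonempty A := ⟨hSA.some.2⟩
  have hd := dim_pos_of_sigmaMin_pos hσ0
  have hZ := Fintype.card_pos (α := Z)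
  obtain ⟨hL0, hprob⟩ := card_mul_exp_neg_logFactor_le hd (Fintype.card_pos (α := S))
    (Fintype.card_pos (α := A)) hZ hδ0 hδ1
  rw [← hL] at hL0 hprob
  have h1γ : 0 < 1 - M.discount := by linarith [M.discount_lt_one]
  have hn0 : 0 < n := by
    have hd' : (0 : ℝ) < d := by exact_mod_cast hd
    have hZ' : (0 : ℝ) < Fintype.card Z := by exact_mod_cast hZ
    have : (0 : ℝ) < n := lt_of_lt_of_le (by positivity) hn
    exact_mod_cast this
  -- the weight of the value function
  set T := ConfoundedMDP.transitionMatrix φ ν π with hT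
  have hdet := (isUnit_iff_isUnit_det _).1
    (TwoStage.isUnit_one_sub_transitionMatrix (π := π) hlin hσ0)
  set θ := (1 - M.discount • T)⁻¹ *ᵥ w with hθdef
  have hθ : θ - M.discount • (T *ᵥ θ) = w := by
    rw [← smul_mulVec]
    nth_rw 1 [← one_mulVec θ]
    rw [← sub_mulVec, hθdef, mulVec_mulVec, mul_nonsing_inv _ hdet, one_mulVec]
  have hbad := (ConfoundedMDP.measureReal_not_concentrated_le (n := n) (π := π) hlin hinstr hθ
    (x := 4 * L) (by positivity)).trans hprob
  set μ := M.datasetLaw p ρ n with hμ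
  have hcover : 1 ≤ μ.real {ω | TwoStage.Concentrated φ π p ρ T θ M.discount (4 * L)
      fun i => M.observe (ω i)} + μ.real {ω | ¬ TwoStage.Concentrated φ π p ρ T θ M.discount
      (4 * L) fun i => M.observe (ω i)} := by
    refine le_trans (le_of_eq ?_) (measureReal_union_le _ _)
    rw [← Set.ofPred_or]
    simp [em]
  refine (by linarith : 1 - δ ≤ _).trans (measureReal_mono (μ := μ) fun ω hω => ?_)
  exact TwoStage.Concentrated.wellDefined_and_abs_sub_le hlin hσ0 hL0.le hn0 hZ hθ hn hω
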